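/- **Setting.** Let $f_1:\mathbb R^n\to\mathbb R\cup\{+\infty\}$ be proper, lower semicontinuous and convex, and write $\operatorname{dom} f_1=\{x: f_1(x)<+\infty\}$. Let $f_0:\mathbb R^n\to\mathbb R$ be continuously differentiable on an open set $\Omega_0\supseteq\overline{\operatorname{dom} f_1}$, with $\|\nabla f_0(x)-\nabla f_0(y)\|\le L\|x-y\|$ for all $x,y\in\operatorname{dom} f_1$ and some $L>0$. Let $f=f_0+f_1$ be bounded from below. Norms are Euclidean. **Subdifferentials and the KL property.** Let $F:\mathbb R^N\to\mathbb R\cup\{+\infty\}$ be proper and lower semicontinuous. The Fréchet subdifferential $\hat\partial F(z)$ at $z\in\operatorname{dom}F$ is the set of all $w$ with $\liminf_{u\to z,\,u\ne z}\frac{F(u)-F(z)-\langle u-z,w\rangle}{\|u-z\|}\ge 0$, and it is empty for $z\notin\operatorname{dom}F$. The limiting subdifferential $\partial F(z)$ at $z\in\operatorname{dom}F$ is the set of all limits $w=\lim_j w_j$ with $w_j\in\hat\partial F(z_j)$, $z_j\to z$, $F(z_j)\to F(z)$; it is empty for $z\notin\operatorname{dom}F$. A point $z$ is stationary for $F$ if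 $0\in\partial F(z)$. Put $\|\partial F(z)\|_-=\inf_{v\in\partial F(z)}\|v\|$ (equal to $+\infty$ if $\partial F(z)=\emptyset$). $F$ is a KL function if for every $\bar z$ with $\partial F(\bar z)\neq\emptyset$ there are $\upsilon\in(0,+\infty]$, a neighbourhood $U$ of $\bar z$ and a continuous concave function $\phi:[0,\upsilon)\to[0,+\infty)$ with $\phi(0)=0$, $\phi\in C^1(0,\upsilon)$ and $\phi'>0$ on $(0,\upsilon)$, such that $\phi'(F(z)-F(\bar z))\,\|\partial F(z)\|_-\ge1$ for all $z\in U$ with $F(\bar z)<F(z)<F(\bar z)+\upsilon$. **Algorithm i²Piano.** Choose $x^{(-1)},x^{(0)}\in\operatorname{dom} f_1$, $\delta\ge\gamma>0$, $\eta>1$, $0<L_{\min}\le L_{\max}$ and $\tau\ge0$. Set $\theta=2/(\sqrt{2+\tau}+\sqrt\tau)^2$, and choose $\omega\in[0,1)$ if $\tau>0$, $\omega\in[0,1]$ if $\tau=0$. For $k=0,1,2,\dots$: 1. Choose $L_k\in[L_{\min},L_{\max}]$. 2. Set $b_k=\dfrac{L_k+2\delta}{L_k+2\gamma}$. 3. Set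 $\beta_k=\dfrac{1+\theta\omega}{2}\cdot\dfrac{b_k-1}{b_k-\frac12}$. 4. Set $\alpha_k=\dfrac{1+\theta\omega-2\beta_k}{L_k+2\gamma}$. 5. With $$h^{(k)}(y;x,s)=f_1(y)-f_1(x)+\Big\langle\nabla f_0(x)-\tfrac{\beta_k}{\alpha_k}(x-s),\,y-x\Big\rangle+\tfrac1{2\alpha_k}\|y-x\|^2,$$ compute any $\tilde y^{(k)}\in\operatorname{dom} f_1$ such that $$0\in\partial_{\epsilon_k}h^{(k)}(\tilde y^{(k)};x^{(k)},x^{(k-1)}),\qquad \epsilon_k=-\tfrac\tau2\,h^{(k)}(\tilde y^{(k)};x^{(k)},x^{(k-1)}),$$ where $\partial_\epsilon g(y)=\{w: g(z)\ge g(y)+\langle w,z-y\rangle-\epsilon\ \ \forall z\in\mathbb R^n\}$ and $\partial_{\epsilon_k}h^{(k)}$ is taken with respect to the first argument. 6. If $f_0(\tilde y^{(k)})\le f_0(x^{(k)})+\langle\nabla f_0(x^{(k)}),\tilde y^{(k)}-x^{(k)}\rangle+\frac{L_k}2\|\tilde y^{(k)}-x^{(k)}\|^2$, set $x^{(k+1)}=\tilde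 y^{(k)}$; otherwise replace $L_k$ by $\eta L_k$ and go back to step 2. **Theorem.** Suppose that the merit function $\mathcal F:\mathbb R^n\times\mathbb R\to\mathbb R\cup\{+\infty\}$, $\mathcal F(u,\rho)=f(u)+\frac12\rho^2$, is a KL function, and let $\{x^{(k)}\}_{k\in\mathbb N}$ be a sequence generated by i²Piano that is bounded. Then $\{x^{(k)}\}_{k\in\mathbb N}$ converges to a stationary point of $f$, i.e. to a point $x^*$ with $0\in\partial f(x^*)$. -/

import Mathlib

open Filter Topology
open scoped InnerProductSpace

noncomputable section

namespace I2Piano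

section VariationalAnalysis

variable {H : Type*} [NormedAddCommGroup H] [InnerProductSpace ℝ H]

/-- The (effective) domain of an extended-real-valued function. -/
def dom (F : H → EReal) : Set H := {z | F z < ⊤}

/-- Proper: nonempty domain, and finite on the domain (so the value `-∞` is never taken). -/
def IsProper (F : H → EReal) : Prop := (dom F).Nonempty ∧ ∀ z ∈ dom F, F z ≠ ⊥

/-- Convexity of an extended-real-valued function. It is used for proper functions only, for which
the right-hand side never has the form `∞ - ∞`. -/
def IsConvex (F : H → EReal) : Prop :=
  ∀ x y : H, ∀ a b : ℝ, 0 < a → 0 < b → a + b = 1 →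
    F (a • x + b • y) ≤ (a : EReal) * F x + (b : EReal) * F y

/-- The Fréchet subdifferential (empty outside the domain). -/
def frechetSubdiff (F : H → EReal) (z : H) : Set H :=
  {w | z ∈ dom F ∧
    0 ≤ liminf (fun u => (F u - F z - ((⟪u - z, w⟫_ℝ : ℝ) : EReal)) / ((‖u - z‖ : ℝ) : EReal))
      (𝓝[≠] z)}

/-- The limiting subdifferential (empty outside the domain). -/
def limitingSubdiff (F : H → EReal) (z : H) : Set H :=
  {w | z ∈ dom F ∧ ∃ u v : ℕ → H,
    Tendsto u atTop (𝓝 z) ∧ Tendsto (fun k => F (u k)) atTop (𝓝 (F z)) ∧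
    (∀ k, v k ∈ frechetSubdiff F (u k)) ∧ Tendsto v atTop (𝓝 w)}

/-- Stationary points, in the sense of the limiting subdifferential. -/
def IsStationary (F : H → EReal) (z : H) : Prop := (0 : H) ∈ limitingSubdiff F z

/-- The lazy slope `inf {‖v‖ : v ∈ ∂F(z)}`, with value `+∞` if `∂F(z)` is empty. -/
def lazySlope (F : H → EReal) (z : H) : ENNReal := ⨅ v ∈ limitingSubdiff F z, ‖v‖ₑ

/-- The Kurdyka–Łojasiewicz inequality around the point `zbar`. -/
def HasKLPropertyAt (F : H → EReal) (zbar : H) : Prop :=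
  ∃ υ : EReal, 0 < υ ∧ ∃ U ∈ 𝓝 zbar, ∃ φ : ℝ → ℝ,
    ContinuousOn φ {s : ℝ | 0 ≤ s ∧ (s : EReal) < υ} ∧
    ConcaveOn ℝ {s : ℝ | 0 ≤ s ∧ (s : EReal) < υ} φ ∧
    (∀ s : ℝ, 0 ≤ s → (s : EReal) < υ → 0 ≤ φ s) ∧
    φ 0 = 0 ∧
    ContDiffOn ℝ 1 φ {s : ℝ | 0 < s ∧ (s : EReal) < υ} ∧
    (∀ s : ℝ, 0 < s → (s : EReal) < υ → 0 < deriv φ s) ∧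
    ∀ z ∈ U, F zbar < F z → F z < F zbar + υ →
      1 ≤ ENNReal.ofReal (deriv φ (F z - F zbar).toReal) * lazySlope F z

/-- KL functions. The KL property is a condition on the points of `dom ∂F`; at all other points of
`dom F` the inequality holds automatically, because `∂F` has closed graph with respect to
`F`-attentive convergence. -/
def IsKL (F : H → EReal) : Prop :=
  ∀ zbar : H, (limitingSubdiff F zbar).Nonempty → HasKLPropertyAt F zbar

/-- The `ε`-subdifferential of a convex function `g` at `y`. -/
def epsSubdiff (g : H → EReal) (ε : ℝ) (y : H) : Set H :=
  {w | ∀ z : H, g y + ((⟪w, z - y⟫_ℝ - ε : ℝ) : EReal) ≤ g z}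

end VariationalAnalysis

section Algorithm

variable {n : ℕ}

/-- The objective `f = f₀ + f₁`. -/
def objective (f0 : EuclideanSpace ℝ (Fin n) → ℝ) (f1 : EuclideanSpace ℝ (Fin n) → EReal)
    (x : EuclideanSpace ℝ (Fin n)) : EReal := (f0 x : EReal) + f1 x

/-- The merit function `(u, ρ) ↦ f(u) + ρ²/2` on `ℝⁿ × ℝ` with its Euclidean structure. -/
def merit (f : EuclideanSpace ℝ (Fin n) → EReal)
    (p : WithLp 2 (EuclideanSpace ℝ (Fin n) × ℝ)) : EReal :=
  f p.fst + ((p.snd ^ 2 / 2 : ℝ) : EReal)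

/-- The input parameters of i²Piano, with their constraints. -/
structure Params where
  (δ γ η Lmin Lmax τ ω : ℝ)
  γ_pos : 0 < γ
  γ_le_δ : γ ≤ δ
  one_lt_η : 1 < η
  Lmin_pos : 0 < Lmin
  Lmin_le_Lmax : Lmin ≤ Lmax
  τ_nonneg : 0 ≤ τ
  ω_nonneg : 0 ≤ ω
  ω_le_one : ω ≤ 1
  ω_lt_one : 0 < τ → ω < 1

namespace Params

variable (P : Params)

def θ : ℝ := 2 / (√(2 + P.τ) + √P.τ) ^ 2

/-- The number `b_k` (Step 2), as a function of the current value of `L_k`. -/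
def b (L : ℝ) : ℝ := (L + 2 * P.δ) / (L + 2 * P.γ)

/-- The inertial parameter `β_k` (Step 3), as a function of the current value of `L_k`. -/
def β (L : ℝ) : ℝ := (1 + P.θ * P.ω) / 2 * ((P.b L - 1) / (P.b L - 1 / 2))

/-- The stepsize `α_k` (Step 4), as a function of the current value of `L_k`. -/
def α (L : ℝ) : ℝ := (1 + P.θ * P.ω - 2 * P.β L) / (L + 2 * P.γ)

end Params

/-- `h(y; x, s)`, the function minimized by the inertial proximal gradient point. -/
def h (f0 : EuclideanSpace ℝ (Fin n) → ℝ) (f1 : EuclideanSpace ℝ (Fin n) → EReal) (α β : ℝ)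
    (y x s : EuclideanSpace ℝ (Fin n)) : EReal :=
  f1 y - f1 x +
    ((⟪gradient f0 x - (β / α) • (x - s), y - x⟫_ℝ + 1 / (2 * α) * ‖y - x‖ ^ 2 : ℝ) : EReal)

/-- `y` is an inexact inertial proximal gradient point (Step 5):
`y ∈ dom f₁` and `0 ∈ ∂_ε h(y; x, s)` with `ε = -(τ/2) h(y; x, s)`. -/
def IsInexactProx (P : Params) (f0 : EuclideanSpace ℝ (Fin n) → ℝ)
    (f1 : EuclideanSpace ℝ (Fin n) → EReal) (L : ℝ) (x s y : EuclideanSpace ℝ (Fin n)) : Prop :=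
  y ∈ dom f1 ∧
    0 ∈ epsSubdiff (fun z => h f0 f1 (P.α L) (P.β L) z x s)
      (-(P.τ / 2) * (h f0 f1 (P.α L) (P.β L) y x s).toReal) y

/-- The local descent test (Step 6). -/
def LocalDescent (f0 : EuclideanSpace ℝ (Fin n) → ℝ) (L : ℝ)
    (x y : EuclideanSpace ℝ (Fin n)) : Prop :=
  f0 y ≤ f0 x + ⟪gradient f0 x, y - x⟫_ℝ + L / 2 * ‖y - x‖ ^ 2

/-- One iteration of i²Piano, from `(x^{(k)}, x^{(k-1)}) = (x, s)` to `x^{(k+1)} = xnext`: a first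
tentative value `L₀ ∈ [Lmin, Lmax]` is chosen, the `i`-th tentative value is `η ^ i * L₀` with
tentative point `y i`, the tentative points `y 0, …, y (m - 1)` are rejected by the local descent
test, and `y m` is accepted. -/
def IsIteration (P : Params) (f0 : EuclideanSpace ℝ (Fin n) → ℝ)
    (f1 : EuclideanSpace ℝ (Fin n) → EReal) (s x xnext : EuclideanSpace ℝ (Fin n)) : Prop :=
  ∃ L₀ ∈ Set.Icc P.Lmin P.Lmax, ∃ m : ℕ, ∃ y : ℕ → EuclideanSpace ℝ (Fin n),
    (∀ i ≤ m, IsInexactProx P f0 f1 (P.η ^ i * L₀) x s (y i)) ∧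
    (∀ i < m, ¬ LocalDescent f0 (P.η ^ i * L₀) x (y i)) ∧
    LocalDescent f0 (P.η ^ m * L₀) x (y m) ∧
    xnext = y m

/-- The previous iterate `x^{(k-1)}`, where `xm1 = x^{(-1)}`. -/
def prev (xm1 : EuclideanSpace ℝ (Fin n)) (x : ℕ → EuclideanSpace ℝ (Fin n)) :
    ℕ → EuclideanSpace ℝ (Fin n)
  | 0 => xm1
  | k + 1 => x k

/-- `x` is a sequence generated by i²Piano from the starting points `x^{(-1)} = xm1`, `x^{(0)} = x 0`
in `dom f₁`. -/
def IsGenerated (P : Params) (f0 : EuclideanSpace ℝ (Fin n) → ℝ)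
    (f1 : EuclideanSpace ℝ (Fin n) → EReal) (xm1 : EuclideanSpace ℝ (Fin n))
    (x : ℕ → EuclideanSpace ℝ (Fin n)) : Prop :=
  xm1 ∈ dom f1 ∧ x 0 ∈ dom f1 ∧ ∀ k, IsIteration P f0 f1 (prev xm1 x k) (x k) (x (k + 1))

end Algorithm

end I2Piano

end

namespace I2Piano

/-! ### Fréchet subgradients and the integrated KL inequality. -/

section Subdifferential

/-! The Lyapunov values `Φ k = f(x k) + δ‖x k - x (k-1)‖²` decrease by at least `d k ^ 2 = γ‖x k - x
(k-1)‖² + q k`, where `q k` is the share `1 - ω` of the decrease of the proximal model. The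
parameter rules for `α`, `β`, `θ` are exactly those that make this balance close.

An inexact proximal point carries no small subgradient of `f`. The exact minimizer `p k` of the same
strongly convex model does, and `exists_exact_prox` bounds its distance to the inexact one by the
model decrease. `exists_iterationEstimate` then bounds `‖p k - x k‖` and a subgradient at `p k` by a
multiple of `d k + d (k+1)`, and the gaps in function value by its square.

The values `f(p k)` need not dominate the Lyapunov values, and the second variable of the merit
function repairs this: `ρ k` is chosen so that `merit(p k, ρ k) ≥ Φ (k+1)`, while `ρ k` and the
corresponding component of the subgradient stay of order `d k + d (k+1)`. Concavity of the
desingularizing function `φ` transfers the KL inequality at this higher level down to the interval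
between `Φ (k+2)` and `Φ (k+1)` (`HasKLPropertyAt.exists_sub_le_mul_norm`). This gives `d (k+1) ^ 2
≤ const · (d k + d (k+1)) · Δφ`, hence by AM-GM a recursion with a telescoping right-hand side.
`tendsto_of_telescoping_near_cluster` keeps the iterates near a cluster point, which is therefore
the limit. It is stationary because the subgradients at `p k` tend to zero and `f(p k)` converges to
the value of `f` there. -/

theorem IsProper.coe_toReal {H : Type*} {F : H → EReal} (hF : IsProper F) {z : H} (hz : z ∈ dom F) :
    ((F z).toReal : EReal) = F z :=
  EReal.coe_toReal (ne_of_lt hz) (hF.2 z hz)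

theorem eq_top_of_notMem_dom {H : Type*} {F : H → EReal} {z : H} (hz : z ∉ dom F) : F z = ⊤ :=
  not_lt_top_iff.mp hz

variable {H : Type*} [NormedAddCommGroup H] [InnerProductSpace ℝ H]

theorem IsConvex.convexOn_toReal {F : H → EReal} (hF : IsProper F) (hc : IsConvex F) :
    ConvexOn ℝ (dom F) (fun z => (F z).toReal) := by
  have key : ∀ x ∈ dom F, ∀ y ∈ dom F, ∀ a b : ℝ, 0 < a → 0 < b → a + b = 1 →
      F (a • x + b • y) ≤ ((a * (F x).toReal + b * (F y).toReal : ℝ) : EReal) := by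
    intro x hx y hy a b ha hb hab
    have := hc x y a b ha hb hab
    rw [← hF.coe_toReal hx, ← hF.coe_toReal hy] at this
    exact_mod_cast this
  have hconv : Convex ℝ (dom F) := by
    rw [convex_iff_forall_pos]
    intro x hx y hy a b ha hb hab
    exact (key x hx y hy a b ha hb hab).trans_lt (EReal.coe_lt_top _)
  refine convexOn_iff_forall_pos.mpr ⟨hconv, fun x hx y hy a b ha hb hab => ?_⟩
  have h := key x hx y hy a b ha hb hab
  rw [← hF.coe_toReal (hconv hx hy ha.le hb.le hab)] at h
  simpa using EReal.coe_le_coe_iff.mp h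

/-- A function that is minorized to first order at `z` has the corresponding Fréchet subgradient. -/
theorem mem_frechetSubdiff_of_eventually {F : H → EReal} {z w : H} {c : ℝ} (hc : F z = c)
    (hF : ∀ ε : ℝ, 0 < ε → ∀ᶠ u in 𝓝 z,
      ((c + ⟪u - z, w⟫_ℝ - ε * ‖u - z‖ : ℝ) : EReal) ≤ F u) :
    w ∈ frechetSubdiff F z := by
  refine ⟨by rw [dom, Set.mem_ofPred_eq, hc]; exact EReal.coe_lt_top c, ?_⟩
  refine le_of_forall_lt fun b hb => ?_
  obtain ⟨r, hbr, hr⟩ := EReal.lt_iff_exists_real_btwn.mp hb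
  refine hbr.trans_le (le_liminf_of_le (by isBoundedDefault) ?_)
  have hr0 : r < 0 := by exact_mod_cast hr
  filter_upwards [(hF (-r) (by linarith)).filter_mono nhdsWithin_le_nhds,
    self_mem_nhdsWithin] with u hu hne
  have hpos : 0 < ‖u - z‖ := norm_pos_iff.mpr (sub_ne_zero.mpr hne)
  rw [EReal.le_div_iff_mul_le (by exact_mod_cast hpos) (EReal.coe_ne_top _), hc]
  induction hFu : F u with
  | bot =>
    rw [hFu] at hu
    exact absurd (le_bot_iff.mp hu) (EReal.coe_ne_bot _)
  | top => simp
  | coe t =>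
    rw [hFu] at hu
    have hu' := EReal.coe_le_coe_iff.mp hu
    have : r * ‖u - z‖ ≤ t - c - ⟪u - z, w⟫_ℝ := by linarith
    exact_mod_cast this

theorem frechetSubdiff_subset_limitingSubdiff (F : H → EReal) (z : H) :
    frechetSubdiff F z ⊆ limitingSubdiff F z := fun w hw =>
  ⟨hw.1, fun _ => z, fun _ => w, tendsto_const_nhds, tendsto_const_nhds, fun _ => hw,
    tendsto_const_nhds⟩

/-- The KL inequality in integrated form: decrease of the function value is controlled by the
decrease of the desingularized value and the size of any subgradient. -/
theorem HasKLPropertyAt.exists_sub_le_mul_norm {F : H → EReal} {zbar : H} {c : ℝ}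
    (hKL : HasKLPropertyAt F zbar) (hc : F zbar = c) :
    ∃ υ : ℝ, 0 < υ ∧ ∃ U ∈ 𝓝 zbar, ∃ φ : ℝ → ℝ, Tendsto φ (𝓝[≥] 0) (𝓝 0) ∧
      (∀ s, 0 ≤ s → s < υ → 0 ≤ φ s) ∧
      ∀ z ∈ U, ∀ w ∈ limitingSubdiff F z, ∀ s t t' : ℝ, F z = ((c + s : ℝ) : EReal) →
        0 ≤ t' → t' < t → t ≤ s → s < υ →
          0 ≤ φ t - φ t' ∧ t - t' ≤ (φ t - φ t') * ‖w‖ := by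
  obtain ⟨υ', hυ', U, hU, φ, hcont, hconc, hnonneg, hφ0, hdiff, hderiv, hineq⟩ := hKL
  -- The given bound may be `+∞`; any smaller positive real serves.
  obtain ⟨υ, h0υ, hυυ'⟩ := EReal.lt_iff_exists_real_btwn.mp hυ'
  have hυ : 0 < υ := by exact_mod_cast h0υ
  have hlt : ∀ s : ℝ, s < υ → (s : EReal) < υ' := fun s hs =>
    lt_trans (by exact_mod_cast hs) hυυ'
  refine ⟨υ, hυ, U, hU, φ, ?_, fun s hs hsυ => hnonneg s hs (hlt s hsυ), ?_⟩
  · have h1 : ContinuousWithinAt φ (Set.Ico 0 υ) 0 :=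
      (hcont 0 ⟨le_rfl, hlt 0 hυ⟩).mono fun s hs => ⟨hs.1, hlt s hs.2⟩
    have h2 : ContinuousWithinAt φ (Set.Ici 0) 0 :=
      h1.mono_of_mem_nhdsWithin (Ico_mem_nhdsGE hυ)
    simpa [ContinuousWithinAt, hφ0] using h2
  · intro z hz w hw s t t' hFz ht' htt' hts hsυ
    have hs : 0 < s := by linarith
    have hdiffAt : DifferentiableAt ℝ φ s := by
      have h1 : ContDiffOn ℝ 1 φ (Set.Ioo 0 υ) := hdiff.mono fun u hu => ⟨hu.1, hlt u hu.2⟩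
      exact (h1.differentiableOn one_ne_zero).differentiableAt (Ioo_mem_nhds hs hsυ)
    have hpos := hderiv s hs (hlt s hsυ)
    have hS : ∀ u : ℝ, 0 ≤ u → u ≤ s → u ∈ {s : ℝ | 0 ≤ s ∧ (s : EReal) < υ'} :=
      fun u hu hus => ⟨hu, hlt u (by linarith)⟩
    -- The derivative of a concave function at `s` is at most its slope over any interval to the
    -- left. For `t < s` the comparison passes through the slope over `[t, s]`, which degenerates
    -- when `t = s`.
    have hslope : deriv φ s * (t - t') ≤ φ t - φ t' := by
      rcases hts.eq_or_lt with rfl | hts'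
      · have := hconc.deriv_le_slope (hS t' ht' htt'.le) (hS t hs.le le_rfl) htt' hdiffAt
        rw [slope_def_field, le_div_iff₀ (by linarith)] at this
        exact this
      · have h1 := hconc.deriv_le_slope (hS t (by linarith) hts) (hS s hs.le le_rfl) hts' hdiffAt
        have h2 := hconc.slope_anti_adjacent (hS t' ht' (by linarith)) (hS s hs.le le_rfl)
          htt' hts'
        rw [slope_def_field] at h1
        have := h1.trans h2
        rwa [le_div_iff₀ (by linarith)] at this
    have hone : 1 ≤ deriv φ s * ‖w‖ := by
      have h1 := hineq z hz (by rw [hc, hFz]; exact_mod_cast (by linarith))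
        (by
          rw [hc, hFz, EReal.coe_add]
          exact EReal.add_lt_add_left_coe (hlt s hsυ) c)
      have h2 : (F z - F zbar).toReal = s := by
        rw [hc, hFz, ← EReal.coe_sub, EReal.toReal_coe]; ring
      have h3 : lazySlope F z ≤ ‖w‖ₑ := iInf₂_le w hw
      rw [h2] at h1
      have h4 := h1.trans (mul_le_mul_right h3 _)
      rw [← ofReal_norm, ← ENNReal.ofReal_mul hpos.le] at h4
      exact ENNReal.one_le_ofReal.mp h4
    have hd : 0 < t - t' := by linarith
    refine ⟨(mul_pos hpos hd).le.trans hslope, ?_⟩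
    calc t - t' ≤ (deriv φ s * ‖w‖) * (t - t') := le_mul_of_one_le_left hd.le hone
      _ = (deriv φ s * (t - t')) * ‖w‖ := by ring
      _ ≤ _ := by gcongr

end Subdifferential

/-! ### Minimizers of strongly convex models. -/

section StronglyConvex

variable {H : Type*} [NormedAddCommGroup H] [InnerProductSpace ℝ H]

/-- Perturbing a convex function by an affine one and a quadratic makes it strongly convex. -/
theorem strongly_convex_add_quadratic {D : Set H} {g : H → ℝ} (hg : ConvexOn ℝ D g) (x c : H)
    (a : ℝ) {u v : H} (hu : u ∈ D) (hv : v ∈ D) {t : ℝ} (ht0 : 0 ≤ t) (ht1 : t ≤ 1) :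
    g ((1 - t) • u + t • v) + ⟪c, (1 - t) • u + t • v - x⟫_ℝ
        + a / 2 * ‖(1 - t) • u + t • v - x‖ ^ 2 ≤
      (1 - t) * (g u + ⟪c, u - x⟫_ℝ + a / 2 * ‖u - x‖ ^ 2)
        + t * (g v + ⟪c, v - x⟫_ℝ + a / 2 * ‖v - x‖ ^ 2)
        - a / 2 * (t * (1 - t)) * ‖v - u‖ ^ 2 := by
  have h := hg.2 hu hv (by linarith : 0 ≤ 1 - t) ht0 (by ring)
  simp only [smul_eq_mul] at h
  obtain ⟨p, rfl⟩ : ∃ p, u = p + x := ⟨u - x, by simp⟩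
  obtain ⟨q, rfl⟩ : ∃ q, v = q + x := ⟨v - x, by simp⟩
  have e1 : (1 - t) • (p + x) + t • (q + x) - x = (1 - t) • p + t • q := by module
  have e2 : ‖(1 - t) • p + t • q‖ ^ 2
      = (1 - t) * ‖p‖ ^ 2 + t * ‖q‖ ^ 2 - t * (1 - t) * ‖q - p‖ ^ 2 := by
    rw [← real_inner_self_eq_norm_sq, ← real_inner_self_eq_norm_sq, ← real_inner_self_eq_norm_sq,
      ← real_inner_self_eq_norm_sq]
    simp only [inner_add_left, inner_add_right, inner_sub_left, inner_sub_right,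
      real_inner_smul_left, real_inner_smul_right, real_inner_comm p q]
    ring
  rw [e1, e2, inner_add_right, real_inner_smul_right, real_inner_smul_right]
  simp only [add_sub_cancel_right, add_sub_add_right_eq_sub]
  nlinarith [h]

/-- Minimality is tested at the points `(1 - t) • y + t • z`; strong convexity allows division by
`t`, and `t → 0` recovers the full constant `a / 2`. -/
theorem quadratic_growth_of_isMinOn {D : Set H} {g : H → ℝ} (hg : ConvexOn ℝ D g) (x c : H)
    {a : ℝ} {y : H} (hy : y ∈ D)
    (hmin : ∀ z ∈ D, g y + ⟪c, y - x⟫_ℝ + a / 2 * ‖y - x‖ ^ 2 ≤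
      g z + ⟪c, z - x⟫_ℝ + a / 2 * ‖z - x‖ ^ 2) {z : H} (hz : z ∈ D) :
    g y + ⟪c, y - x⟫_ℝ + a / 2 * ‖y - x‖ ^ 2 + a / 2 * ‖z - y‖ ^ 2 ≤
      g z + ⟪c, z - x⟫_ℝ + a / 2 * ‖z - x‖ ^ 2 := by
  set A := g y + ⟪c, y - x⟫_ℝ + a / 2 * ‖y - x‖ ^ 2
  set B := g z + ⟪c, z - x⟫_ℝ + a / 2 * ‖z - x‖ ^ 2
  have key : ∀ t ∈ Set.Ioo (0 : ℝ) 1, A + a / 2 * (1 - t) * ‖z - y‖ ^ 2 ≤ B := by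
    intro t ht
    have h1 := strongly_convex_add_quadratic hg x c a hy hz ht.1.le ht.2.le
    have h2 := hmin _ (hg.1 hy hz (by linarith [ht.2] : 0 ≤ 1 - t) ht.1.le (by ring))
    have h3 := h2.trans h1
    have h4 : t * (A + a / 2 * (1 - t) * ‖z - y‖ ^ 2) ≤ t * B := by
      change A ≤ (1 - t) * A + t * B - a / 2 * (t * (1 - t)) * ‖z - y‖ ^ 2 at h3
      linarith
    exact le_of_mul_le_mul_left h4 ht.1
  have hlim : Tendsto (fun t : ℝ => A + a / 2 * (1 - t) * ‖z - y‖ ^ 2) (𝓝[>] 0)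
      (𝓝 (A + a / 2 * (1 - 0) * ‖z - y‖ ^ 2)) :=
    (Continuous.tendsto (by fun_prop) 0).mono_left nhdsWithin_le_nhds
  have := le_of_tendsto hlim (by
    filter_upwards [Ioo_mem_nhdsGT (zero_lt_one' ℝ)] with t ht using key t ht)
  simpa using this

/-- A lower semicontinuous convex function plus an affine function plus a quadratic attains its
minimum, with quadratic growth, as soon as it is bounded below. -/
theorem exists_quadratic_growth [ProperSpace H] {F : H → EReal} (hF : IsProper F)
    (hlsc : LowerSemicontinuous F) (hconv : IsConvex F) (x c : H) (hx : x ∈ dom F) {a : ℝ}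
    (ha : 0 < a) {m : ℝ}
    (hm : ∀ z ∈ dom F, m ≤ (F z).toReal + ⟪c, z - x⟫_ℝ + a / 2 * ‖z - x‖ ^ 2) :
    ∃ y ∈ dom F, ∀ z ∈ dom F,
      (F y).toReal + ⟪c, y - x⟫_ℝ + a / 2 * ‖y - x‖ ^ 2 + a / 2 * ‖z - y‖ ^ 2 ≤
        (F z).toReal + ⟪c, z - x⟫_ℝ + a / 2 * ‖z - x‖ ^ 2 := by
  have hg := hconv.convexOn_toReal hF
  set q : H → ℝ := fun z => (F z).toReal + ⟪c, z - x⟫_ℝ + a / 2 * ‖z - x‖ ^ 2 with hq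
  -- The extended-valued `G` carries lower semicontinuity, its real counterpart `q` the arithmetic.
  set G : H → EReal := fun z => F z + ((⟪c, z - x⟫_ℝ + a / 2 * ‖z - x‖ ^ 2 : ℝ) : EReal) with hG
  have hGq : ∀ z ∈ dom F, G z = q z := by
    intro z hz
    simp only [hG, hq]
    rw [← hF.coe_toReal hz, ← EReal.coe_add, EReal.toReal_coe, add_assoc]
  have hGlsc : LowerSemicontinuous G := by
    refine hlsc.add' ?_ fun z => EReal.continuousAt_add (Or.inr (EReal.coe_ne_bot _))
      (Or.inr (EReal.coe_ne_top _))
    exact (continuous_coe_real_ereal.comp (by fun_prop)).lowerSemicontinuous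
  -- Beyond this radius `q` exceeds `q x`: the midpoint of `x` and `z` has value at least `m`, and
  -- strong convexity gains `a / 8 * ‖z - x‖ ^ 2` there.
  set R : ℝ := √(8 * (q x - m) / a)
  have hmx : m ≤ q x := hm x hx
  obtain ⟨y, hyball, hymin⟩ := LowerSemicontinuousOn.exists_isMinOn
    (s := Metric.closedBall x R) ⟨x, Metric.mem_closedBall_self (Real.sqrt_nonneg _)⟩
    (isCompact_closedBall x R) (hGlsc.lowerSemicontinuousOn _)
  have hyx : G y ≤ G x := hymin (Metric.mem_closedBall_self (Real.sqrt_nonneg _))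
  have hy : y ∈ dom F := by
    by_contra hy
    rw [hGq x hx] at hyx
    have : G y = ⊤ := by simp only [hG]; rw [eq_top_of_notMem_dom hy, EReal.top_add_coe]
    rw [this] at hyx
    exact absurd hyx (not_le.mpr (EReal.coe_lt_top _))
  have hqyx : q y ≤ q x := by
    rw [hGq x hx, hGq y hy] at hyx
    exact_mod_cast hyx
  refine ⟨y, hy, fun z hz => quadratic_growth_of_isMinOn hg x c hy (fun z hz => ?_) hz⟩
  change q y ≤ q z
  by_cases hzR : z ∈ Metric.closedBall x R
  · have : G y ≤ G z := hymin hzR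
    rw [hGq z hz, hGq y hy] at this
    exact_mod_cast this
  · refine hqyx.trans ?_
    have hR : 8 * (q x - m) / a < ‖z - x‖ ^ 2 := by
      rw [Metric.mem_closedBall, not_le, dist_eq_norm] at hzR
      exact (Real.sqrt_lt' ((Real.sqrt_nonneg _).trans_lt hzR)).mp hzR
    rw [div_lt_iff₀ ha] at hR
    have h1 := strongly_convex_add_quadratic hg x c a hx hz (t := 1 / 2) (by norm_num) (by norm_num)
    have h2 := hm _ (hg.1 hx hz (by norm_num : (0 : ℝ) ≤ 1 - 1 / 2)
      (by norm_num : (0 : ℝ) ≤ 1 / 2) (by norm_num))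
    have h3 := h2.trans h1
    change m ≤ (1 - 1 / 2) * q x + 1 / 2 * q z - _ at h3
    linarith

end StronglyConvex

/-! ### The descent lemma. -/

section Descent

variable {H : Type*} [NormedAddCommGroup H] [InnerProductSpace ℝ H] [CompleteSpace H]

/-- The two-sided descent lemma on a convex set. -/
theorem abs_sub_sub_inner_gradient_le {D : Set H} (hD : Convex ℝ D) {f : H → ℝ}
    (hf : ∀ z ∈ D, DifferentiableAt ℝ f z) {L : ℝ}
    (hL : ∀ x ∈ D, ∀ y ∈ D, ‖gradient f x - gradient f y‖ ≤ L * ‖x - y‖) {x y : H}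
    (hx : x ∈ D) (hy : y ∈ D) :
    |f y - f x - ⟪gradient f x, y - x⟫_ℝ| ≤ L / 2 * ‖y - x‖ ^ 2 := by
  set v := y - x
  have hmem : ∀ t ∈ Set.Icc (0 : ℝ) 1, x + t • v ∈ D := fun t ht =>
    hD.add_smul_sub_mem hx hy ht
  have hder : ∀ t ∈ Set.Icc (0 : ℝ) 1,
      HasDerivAt (fun t : ℝ => f (x + t • v) - f x - t * ⟪gradient f x, v⟫_ℝ)
        (⟪gradient f (x + t • v) - gradient f x, v⟫_ℝ) t := by
    intro t ht
    have h1 : HasDerivAt (fun t : ℝ => x + t • v) v t := by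
      simpa using ((hasDerivAt_id t).smul_const v).const_add x
    have h2 := ((hf _ (hmem t ht)).hasGradientAt.hasFDerivAt).comp_hasDerivAt t h1
    have h3 := (h2.sub_const (f x)).sub ((hasDerivAt_id t).mul_const ⟪gradient f x, v⟫_ℝ)
    convert! h3 using 1
    simp [inner_sub_left]
  -- The linearization error along the segment is compared with the parabola `L / 2 * ‖v‖ ^ 2 * t ^
  -- 2`.
  have := image_norm_le_of_norm_deriv_right_le_deriv_boundary (a := 0) (b := 1)
    (f := fun t : ℝ => f (x + t • v) - f x - t * ⟪gradient f x, v⟫_ℝ)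
    (f' := fun t => ⟪gradient f (x + t • v) - gradient f x, v⟫_ℝ)
    (B := fun t => L / 2 * ‖v‖ ^ 2 * t ^ 2) (B' := fun t => L * ‖v‖ ^ 2 * t)
    (fun t ht => (hder t ht).continuousAt.continuousWithinAt)
    (fun t ht => (hder t ⟨ht.1, ht.2.le⟩).hasDerivWithinAt) (by simp)
    (fun t => by
      have := (hasDerivAt_pow 2 t).const_mul (L / 2 * ‖v‖ ^ 2)
      convert! this using 1
      simp
      ring)
    (fun t ht => by
      have h1 := hL _ (hmem t ⟨ht.1, ht.2.le⟩) x hx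
      rw [add_sub_cancel_left, norm_smul, Real.norm_of_nonneg ht.1] at h1
      calc ‖⟪gradient f (x + t • v) - gradient f x, v⟫_ℝ‖
          ≤ ‖gradient f (x + t • v) - gradient f x‖ * ‖v‖ := norm_inner_le_norm _ _
        _ ≤ L * (t * ‖v‖) * ‖v‖ := by gcongr
        _ = L * ‖v‖ ^ 2 * t := by ring)
    (Set.right_mem_Icc.mpr zero_le_one)
  simpa [v] using this

end Descent

/-! ### Trapping a sequence near a cluster point. -/

section Capture

variable {E : Type*} [SeminormedAddCommGroup E]

/-- If a recursive estimate with telescoping right-hand side holds near a cluster point of a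
sequence, then the sequence converges to it. -/
theorem tendsto_of_telescoping_near_cluster {x : ℕ → E} {xs : E} {d ψ : ℕ → ℝ} {A r : ℝ} {K₀ : ℕ}
    (hA : 0 ≤ A) (hr : 0 < r) (hd : ∀ k, 0 ≤ d k) (hψ : ∀ᶠ k in atTop, 0 ≤ ψ k)
    (hd0 : Tendsto d atTop (𝓝 0)) (hψ0 : Tendsto ψ atTop (𝓝 0))
    (hstep : ∀ k, ‖x (k + 1) - x k‖ ≤ A * d (k + 1))
    (hrec : ∀ k, K₀ ≤ k → ‖x k - xs‖ < r → 3 * d (k + 1) ≤ d k + (ψ (k + 1) - ψ (k + 2)))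
    {σ : ℕ → ℕ} (hσ : StrictMono σ) (hclus : Tendsto (x ∘ σ) atTop (𝓝 xs)) :
    Tendsto x atTop (𝓝 xs) := by
  rw [Metric.tendsto_atTop]
  intro ε hε
  set ε' := min ε r
  have hε' : 0 < ε' := lt_min hε hr
  have hψ1 : Tendsto (fun k => ψ (k + 1)) atTop (𝓝 0) := (tendsto_add_atTop_iff_nat 1).mpr hψ0
  have hsum : Tendsto (fun j => ‖x (σ j) - xs‖ + A * (d (σ j) + ψ (σ j + 1))) atTop (𝓝 0) := by
    have h1 := tendsto_iff_norm_sub_tendsto_zero.mp hclus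
    have h2 := ((hd0.add hψ1).comp hσ.tendsto_atTop).const_mul A
    simpa using h1.add h2
  obtain ⟨N, hN⟩ := eventually_atTop.mp hψ
  obtain ⟨j, hj1, hj2⟩ := ((hsum.eventually_lt_const hε').and
    (hσ.tendsto_atTop.eventually_ge_atTop (max K₀ N))).exists
  set K := σ j
  -- This potential does not increase while the iterate is in the ball, and being below `r` it keeps
  -- the next iterate there. Of the three copies of `d (k + 1)` in the recursion, one pays for the
  -- move, one stays in the potential, one is discarded.
  have main : ∀ i, ‖x (K + i) - xs‖ + A * (d (K + i) + ψ (K + i + 1)) ≤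
      ‖x K - xs‖ + A * (d K + ψ (K + 1)) := by
    intro i
    induction i with
    | zero => simp
    | succ i ih =>
      refine le_trans ?_ ih
      have hNi : 0 ≤ ψ (K + i + 1) := hN _ (by have := le_max_right K₀ N; omega)
      have hlt : ‖x (K + i) - xs‖ < r := by
        have h1 : 0 ≤ A * (d (K + i) + ψ (K + i + 1)) := mul_nonneg hA (add_nonneg (hd _) hNi)
        have h2 : ε' ≤ r := min_le_right _ _
        linarith
      have h := hrec (K + i) (by have := le_max_left K₀ N; omega) hlt
      have htri : ‖x (K + i + 1) - xs‖ ≤ A * d (K + i + 1) + ‖x (K + i) - xs‖ :=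
        (norm_sub_le_norm_sub_add_norm_sub _ (x (K + i)) _).trans (by gcongr; exact hstep _)
      have h4 : d (K + i + 1) + (d (K + i + 1) + ψ (K + i + 2)) ≤ d (K + i) + ψ (K + i + 1) := by
        linarith [hd (K + i + 1)]
      have := mul_le_mul_of_nonneg_left h4 hA
      change ‖x (K + i + 1) - xs‖ + A * (d (K + i + 1) + ψ (K + i + 2)) ≤ _
      linarith
  refine ⟨K, fun k hk => ?_⟩
  obtain ⟨i, rfl⟩ := Nat.exists_eq_add_of_le hk
  rw [dist_eq_norm]
  have hNi : 0 ≤ ψ (K + i + 1) := hN _ (by have := le_max_right K₀ N; omega)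
  have h1 : 0 ≤ A * (d (K + i) + ψ (K + i + 1)) := mul_nonneg hA (add_nonneg (hd _) hNi)
  have h2 : ε' ≤ ε := min_le_left _ _
  linarith [main i]

end Capture

/-! ### Inexact versus exact proximal points. -/

section InexactProx

variable {H : Type*} [NormedAddCommGroup H] [InnerProductSpace ℝ H]

/-- The real value of the quadratic model `F z - F x + ⟪c, z - x⟫ + a/2 ‖z - x‖²`. -/
noncomputable def model (F : H → EReal) (c x : H) (a : ℝ) (z : H) : ℝ :=
  (F z).toReal - (F x).toReal + ⟪c, z - x⟫_ℝ + a / 2 * ‖z - x‖ ^ 2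

/-- A relatively inexact minimizer `y` of the model is close to an exact minimizer `p`. -/
theorem exists_exact_prox [ProperSpace H] {F : H → EReal} (hF : IsProper F)
    (hlsc : LowerSemicontinuous F) (hconv : IsConvex F) {x y c : H} (hx : x ∈ dom F)
    (hy : y ∈ dom F) {a τ : ℝ} (ha : 0 < a) (hτ : 0 ≤ τ)
    (hmin : ∀ z ∈ dom F, (1 + τ / 2) * model F c x a y ≤ model F c x a z) :
    model F c x a y ≤ 0 ∧
    a * ‖y - x‖ ^ 2 ≤ (√(2 + τ) + √τ) ^ 2 * -model F c x a y ∧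
    ∃ p ∈ dom F, model F c x a p ≤ 0 ∧
      (∀ z ∈ dom F, (F p).toReal + ⟪-(c + a • (p - x)), z - p⟫_ℝ ≤ (F z).toReal) ∧
      a * ‖y - p‖ ^ 2 ≤ τ * -model F c x a y ∧
      model F c x a y - model F c x a p ≤ τ / 2 * -model F c x a y := by
  have hxx : model F c x a x = 0 := by simp [model]
  have hy0 : model F c x a y ≤ 0 := by
    have := hmin x hx
    rw [hxx] at this
    exact nonpos_of_mul_nonpos_right this (by positivity)
  obtain ⟨p, hp, hgrow⟩ := exists_quadratic_growth hF hlsc hconv x c hx ha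
    (m := (1 + τ / 2) * model F c x a y + (F x).toReal)
    (fun z hz => by have := hmin z hz; simp only [model] at this ⊢; linarith)
  have hgrow' : ∀ z ∈ dom F, model F c x a p + a / 2 * ‖z - p‖ ^ 2 ≤ model F c x a z := by
    intro z hz
    have := hgrow z hz
    simp only [model]
    linarith
  have hpm := hmin p hp
  have h1 := hgrow' x hx
  have h2 := hgrow' y hy
  rw [hxx] at h1
  have hyp : a * ‖y - p‖ ^ 2 ≤ τ * -model F c x a y := by linarith
  have hxp : a * ‖x - p‖ ^ 2 ≤ (2 + τ) * -model F c x a y := by linarith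
  refine ⟨hy0, ?_, p, hp, ?_, fun z hz => ?_, hyp, by linarith⟩
  -- The triangle inequality through `p`: the distances of `y` and `x` to `p`, scaled by `√a`, are
  -- at most `√τ √Q` and `√(2 + τ) √Q`. Their sum is the origin of `θ`.
  · set Q := -model F c x a y
    have hQ : 0 ≤ Q := by simpa [Q] using hy0
    have e1 : √a * ‖y - p‖ ≤ √τ * √Q := by
      rw [← Real.sqrt_mul hτ]
      refine Real.le_sqrt_of_sq_le ?_
      rwa [mul_pow, Real.sq_sqrt ha.le]
    have e2 : √a * ‖x - p‖ ≤ √(2 + τ) * √Q := by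
      rw [← Real.sqrt_mul (by positivity)]
      refine Real.le_sqrt_of_sq_le ?_
      rwa [mul_pow, Real.sq_sqrt ha.le]
    have e3 : ‖y - x‖ ≤ ‖y - p‖ + ‖x - p‖ := by
      rw [norm_sub_rev x p]; exact norm_sub_le_norm_sub_add_norm_sub _ _ _
    have e4 : √a * ‖y - x‖ ≤ (√(2 + τ) + √τ) * √Q := by
      have := mul_le_mul_of_nonneg_left e3 (Real.sqrt_nonneg a)
      linarith
    have e5 := pow_le_pow_left₀ (by positivity) e4 2
    rwa [mul_pow, mul_pow, Real.sq_sqrt ha.le, Real.sq_sqrt hQ] at e5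
  · have : 0 ≤ a / 2 * ‖x - p‖ ^ 2 := by positivity
    linarith
  · have h := hgrow z hz
    have e1 : ‖z - x‖ ^ 2 = ‖z - p‖ ^ 2 + 2 * ⟪p - x, z - p⟫_ℝ + ‖p - x‖ ^ 2 := by
      rw [show z - x = (z - p) + (p - x) by abel, norm_add_sq_real, real_inner_comm]
    have e2 : ⟪c, z - x⟫_ℝ = ⟪c, z - p⟫_ℝ + ⟪c, p - x⟫_ℝ := by
      rw [← inner_add_right]; congr 1; abel
    rw [inner_neg_left, inner_add_left, real_inner_smul_left]
    rw [e1, e2] at h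
    linarith

end InexactProx

/-! ### Algebra of the step parameters. -/

namespace Params

variable (P : Params)

theorem θ_pos : 0 < P.θ := by
  have := P.τ_nonneg
  unfold θ
  positivity

theorem θ_mul_sq : P.θ * (√(2 + P.τ) + √P.τ) ^ 2 = 2 := by
  have := P.τ_nonneg
  unfold θ
  exact div_mul_cancel₀ _ (by positivity)

theorem one_add_θω_pos : 0 < 1 + P.θ * P.ω := by
  have := mul_nonneg P.θ_pos.le P.ω_nonneg
  linarith

/-- The curvature `1 / α` of the quadratic model. -/
noncomputable def curvature (L : ℝ) : ℝ := (L + 4 * P.δ - 2 * P.γ) / (1 + P.θ * P.ω)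

theorem curvature_pos {L : ℝ} (hL : 0 < L) : 0 < P.curvature L :=
  div_pos (by linarith [P.γ_pos, P.γ_le_δ]) P.one_add_θω_pos

theorem β_eq {L : ℝ} (hL : 0 < L) :
    P.β L = 2 * (P.δ - P.γ) * (P.curvature L)⁻¹ := by
  have h1 := P.γ_pos
  have h2 := P.γ_le_δ
  have h3 : L + 2 * P.γ ≠ 0 := by positivity
  have h5 : P.b L - 1 / 2 = (L + 4 * P.δ - 2 * P.γ) / (2 * (L + 2 * P.γ)) := by
    unfold b; field_simp; ring
  have h6 : P.b L - 1 = 2 * (P.δ - P.γ) / (L + 2 * P.γ) := by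
    unfold b; field_simp; ring
  unfold β curvature
  rw [h5, h6]
  have h4 : L + 4 * P.δ - 2 * P.γ ≠ 0 := by linarith
  generalize L + 4 * P.δ - 2 * P.γ = M at h4
  field_simp

theorem α_eq {L : ℝ} (hL : 0 < L) : P.α L = (P.curvature L)⁻¹ := by
  have h1 := P.γ_pos
  have h3 : L + 2 * P.γ ≠ 0 := by positivity
  have h4 : P.curvature L * (1 + P.θ * P.ω) = L + 4 * P.δ - 2 * P.γ :=
    div_mul_cancel₀ _ P.one_add_θω_pos.ne'
  have h5 := (P.curvature_pos hL).ne'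
  unfold α
  rw [P.β_eq hL]
  generalize P.curvature L = a at h4 h5
  field_simp
  linarith

/-- The ratio is independent of `L`, so the inertial term enters the model with a fixed coefficient
that the weights `δ` and `γ` of the Lyapunov function can absorb. -/
theorem β_div_α {L : ℝ} (hL : 0 < L) : P.β L / P.α L = 2 * (P.δ - P.γ) := by
  rw [P.α_eq hL, P.β_eq hL]
  exact mul_div_cancel_right₀ _ (inv_ne_zero (P.curvature_pos hL).ne')

end Params

/-! ### Estimates for a single iteration. -/

section Iteration

variable {n : ℕ} {f0 : EuclideanSpace ℝ (Fin n) → ℝ} {f1 : EuclideanSpace ℝ (Fin n) → EReal}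

theorem h_eq_model (P : Params) (hf1 : IsProper f1) {L : ℝ} (hL : 0 < L)
    {x s z : EuclideanSpace ℝ (Fin n)} (hx : x ∈ dom f1) (hz : z ∈ dom f1) :
    h f0 f1 (P.α L) (P.β L) z x s =
      (model f1 (gradient f0 x - (2 * (P.δ - P.γ)) • (x - s)) x (P.curvature L) z : EReal) := by
  have h1 : 1 / (2 * P.α L) = P.curvature L / 2 := by
    rw [P.α_eq hL, one_div, mul_inv, inv_inv]; ring
  unfold h model
  rw [P.β_div_α hL, h1, ← hf1.coe_toReal hx, ← hf1.coe_toReal hz, ← EReal.coe_sub,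
    ← EReal.coe_add, EReal.toReal_coe, EReal.toReal_coe, add_assoc]

theorem IsInexactProx.model_le {P : Params} (hf1 : IsProper f1) {L : ℝ} (hL : 0 < L)
    {x s y : EuclideanSpace ℝ (Fin n)} (hx : x ∈ dom f1) (hy : IsInexactProx P f0 f1 L x s y)
    {z : EuclideanSpace ℝ (Fin n)} (hz : z ∈ dom f1) :
    (1 + P.τ / 2) *
        model f1 (gradient f0 x - (2 * (P.δ - P.γ)) • (x - s)) x (P.curvature L) y ≤
      model f1 (gradient f0 x - (2 * (P.δ - P.γ)) • (x - s)) x (P.curvature L) z := by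
  have h1 := hy.2 z
  simp only [h_eq_model P hf1 hL hx hz, h_eq_model P hf1 hL hx hy.1, EReal.toReal_coe,
    inner_zero_left] at h1
  rw [← EReal.coe_add, EReal.coe_le_coe_iff] at h1
  linarith

/-- The real value of the objective (meaningful on the domain of `f1`). -/
noncomputable def realObjective (f0 : EuclideanSpace ℝ (Fin n) → ℝ)
    (f1 : EuclideanSpace ℝ (Fin n) → EReal) (z : EuclideanSpace ℝ (Fin n)) : ℝ :=
  f0 z + (f1 z).toReal

theorem objective_eq_coe (hf1 : IsProper f1) {z : EuclideanSpace ℝ (Fin n)} (hz : z ∈ dom f1) :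
    objective f0 f1 z = (realObjective f0 f1 z : EReal) := by
  rw [objective, realObjective, EReal.coe_add, hf1.coe_toReal hz]

theorem objective_eq_top {z : EuclideanSpace ℝ (Fin n)} (hz : z ∉ dom f1) :
    objective f0 f1 z = ⊤ := by
  rw [objective, eq_top_of_notMem_dom hz, EReal.coe_add_top]

/-- Backtracking terminates with a bounded Lipschitz estimate. -/
theorem IsIteration.exists_accepted {P : Params} (hconv : Convex ℝ (dom f1))
    (hdiff : ∀ z ∈ dom f1, DifferentiableAt ℝ f0 z) {L : ℝ}
    (hlip : ∀ x ∈ dom f1, ∀ y ∈ dom f1, ‖gradient f0 x - gradient f0 y‖ ≤ L * ‖x - y‖)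
    {s x y : EuclideanSpace ℝ (Fin n)} (hx : x ∈ dom f1) (hit : IsIteration P f0 f1 s x y) :
    ∃ l, P.Lmin ≤ l ∧ l ≤ max P.Lmax (P.η * L) ∧ IsInexactProx P f0 f1 l x s y ∧
      LocalDescent f0 l x y := by
  obtain ⟨L₀, hL₀, m, u, hprox, hrej, hacc, rfl⟩ := hit
  have hη := P.one_lt_η
  have hLmin := P.Lmin_pos
  refine ⟨P.η ^ m * L₀, ?_, ?_, hprox m le_rfl, hacc⟩
  · exact hL₀.1.trans (le_mul_of_one_le_left (hLmin.le.trans hL₀.1) (one_le_pow₀ hη.le))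
  · cases m with
    | zero => simpa using Or.inl hL₀.2
    | succ m =>
      refine le_max_of_le_right ?_
      rw [pow_succ', mul_assoc]
      refine mul_le_mul_of_nonneg_left ?_ (by linarith)
      -- If the last rejected value exceeded `L`, the descent lemma would have accepted it.
      by_contra hlt
      refine hrej m (Nat.lt_succ_self m) ?_
      have h1 := (abs_le.mp (abs_sub_sub_inner_gradient_le hconv hdiff hlip hx
        (hprox m (Nat.le_succ m)).1)).2
      have h2 : L / 2 * ‖u m - x‖ ^ 2 ≤ P.η ^ m * L₀ / 2 * ‖u m - x‖ ^ 2 := by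
        gcongr
        exact (not_le.mp hlt).le
      unfold LocalDescent
      linarith

/-- All estimates that hold for one iteration from `(s, x)` to `y`, in terms of the step lengths
and a nonnegative number `q`, the guaranteed decrease of the model. The point `p` is the exact
proximal point and `ξ` the subgradient of `f1` at `p` provided by its optimality. -/
structure IterationEstimate (P : Params) (f0 : EuclideanSpace ℝ (Fin n) → ℝ)
    (f1 : EuclideanSpace ℝ (Fin n) → EReal) (C : ℝ) (s x y : EuclideanSpace ℝ (Fin n)) (q : ℝ)
    (p ξ : EuclideanSpace ℝ (Fin n)) : Prop where
  mem_dom : p ∈ dom f1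
  nonneg : 0 ≤ q
  decrease : realObjective f0 f1 y + P.δ * ‖y - x‖ ^ 2 + (P.γ * ‖x - s‖ ^ 2 + q) ≤
    realObjective f0 f1 x + P.δ * ‖x - s‖ ^ 2
  subgradient : ∀ z ∈ dom f1, (f1 p).toReal + ⟪ξ, z - p⟫_ℝ ≤ (f1 z).toReal
  norm_sub_sq_le : ‖p - x‖ ^ 2 ≤ C * (‖x - s‖ ^ 2 + q + ‖y - x‖ ^ 2)
  norm_subgradient_sq_le : ‖ξ + gradient f0 p‖ ^ 2 ≤ C * (‖x - s‖ ^ 2 + q + ‖y - x‖ ^ 2)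
  exact_le : realObjective f0 f1 p ≤
    realObjective f0 f1 x + C * (‖x - s‖ ^ 2 + q + ‖y - x‖ ^ 2)
  le_exact : realObjective f0 f1 y ≤
    realObjective f0 f1 p + C * (‖x - s‖ ^ 2 + q + ‖y - x‖ ^ 2)

theorem inner_le_half_sq_add_half_sq {H : Type*} [NormedAddCommGroup H] [InnerProductSpace ℝ H]
    (u v : H) : ⟪u, v⟫_ℝ ≤ ‖u‖ ^ 2 / 2 + ‖v‖ ^ 2 / 2 := by
  have := sq_nonneg (‖u‖ - ‖v‖)
  nlinarith [real_inner_le_norm u v]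

/-- `C` must not depend on the iteration, which is possible because backtracking keeps the accepted
`l`, and hence the curvature, between two fixed positive bounds. -/
theorem exists_iterationEstimate (P : Params) (hf1 : IsProper f1) (hlsc : LowerSemicontinuous f1)
    (hconv : IsConvex f1) (hdiff : ∀ z ∈ dom f1, DifferentiableAt ℝ f0 z) {L : ℝ} (hL : 0 < L)
    (hlip : ∀ x ∈ dom f1, ∀ y ∈ dom f1, ‖gradient f0 x - gradient f0 y‖ ≤ L * ‖x - y‖) :
    ∃ C : ℝ, 0 ≤ C ∧ ∀ s x y : EuclideanSpace ℝ (Fin n), x ∈ dom f1 →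
      IsIteration P f0 f1 s x y → y ∈ dom f1 ∧ ∃ q p ξ, IterationEstimate P f0 f1 C s x y q p ξ := by
  have hD : Convex ℝ (dom f1) := (hconv.convexOn_toReal hf1).1
  have hγ := P.γ_pos
  have hγδ := P.γ_le_δ
  have hτ := P.τ_nonneg
  have hLmin := P.Lmin_pos
  set κ := 2 * (P.δ - P.γ) with hκ
  have hκ0 : 0 ≤ κ := by linarith
  set a₀ := P.curvature P.Lmin with ha₀
  set a₁ := P.curvature (max P.Lmax (P.η * L)) with ha₁
  have ha₀0 : 0 < a₀ := P.curvature_pos hLmin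
  have ha₁0 : 0 < a₁ := P.curvature_pos (lt_max_of_lt_left (hLmin.trans_le P.Lmin_le_Lmax))
  -- `Cτ` converts the inexactness `τ Q` into the available decrease `q = (1 - ω) Q`. If `τ = 0`,
  -- then `ω = 1` is allowed and `q` may vanish, but there is no inexactness to pay for.
  obtain ⟨Cτ, hCτ0, hCτ⟩ : ∃ Cτ : ℝ, 0 ≤ Cτ ∧ P.τ ≤ Cτ * (1 - P.ω) := by
    rcases hτ.eq_or_lt with h0 | h0
    · exact ⟨0, le_rfl, by rw [← h0, zero_mul]⟩
    · have := P.ω_lt_one h0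
      have h1 : 0 < 1 - P.ω := by linarith
      exact ⟨P.τ / (1 - P.ω), by positivity, by rw [div_mul_cancel₀ _ h1.ne']⟩
  -- `C₁` bounds `‖p - x‖ ^ 2`, `C₂` the squared subgradient, and `C₃`, `C₄` the two function-value
  -- gaps.
  set C₁ := 2 + 2 * (Cτ / a₀) with hC₁
  have hC₁0 : 0 ≤ C₁ := by positivity
  set C₂ := 2 * (L + a₁) ^ 2 * C₁ + 2 * κ ^ 2 with hC₂
  set C₃ := κ / 2 + (κ / 2 + L / 2) * C₁ with hC₃
  set C₄ := Cτ / 2 + κ / 2 + κ / 2 * C₁ + L / 2 + L / 2 * C₁ + a₁ / 2 * C₁ with hC₄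
  have hC₂0 : 0 ≤ C₂ := by positivity
  have hC₃0 : 0 ≤ C₃ := by positivity
  have hC₄0 : 0 ≤ C₄ := by positivity
  refine ⟨C₁ + C₂ + C₃ + C₄, by positivity, fun s x y hx hit => ?_⟩
  obtain ⟨l, hl0, hl1, hprox, hdesc⟩ := hit.exists_accepted hD hdiff hlip hx
  have hl : 0 < l := hLmin.trans_le hl0
  set a := P.curvature l with ha
  have ha0 : 0 < a := P.curvature_pos hl
  have hw := P.one_add_θω_pos
  have haw : a * (1 + P.θ * P.ω) = l + 4 * P.δ - 2 * P.γ := div_mul_cancel₀ _ hw.ne'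
  have haa₀ : a₀ ≤ a := by
    simp only [ha, ha₀, Params.curvature]; gcongr
  have haa₁ : a ≤ a₁ := by
    simp only [ha, ha₁, Params.curvature]; gcongr
  have hy := hprox.1
  obtain ⟨hm0, hyx, p, hp, hp0, hsub, hyp, hmp⟩ := exists_exact_prox hf1 hlsc hconv hx hy ha0 hτ
    (fun z hz => hprox.model_le hf1 hl hx hz)
  set c := gradient f0 x - (2 * (P.δ - P.γ)) • (x - s) with hc
  set Q := -model f1 c x a y with hQ
  have hQ0 : 0 ≤ Q := by linarith
  have hω1 : 0 ≤ 1 - P.ω := by linarith [P.ω_le_one]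
  have hω0 := P.ω_nonneg
  set q := (1 - P.ω) * Q with hq
  have hq0 : 0 ≤ q := mul_nonneg hω1 hQ0
  have hτQ : P.τ * Q ≤ Cτ * q := by
    have := mul_le_mul_of_nonneg_right hCτ hQ0
    rw [hq]; linarith
  have hinner : ∀ z, ⟪c, z - x⟫_ℝ = ⟪gradient f0 x, z - x⟫_ℝ - κ * ⟪x - s, z - x⟫_ℝ := by
    intro z
    rw [hc, inner_sub_left, real_inner_smul_left]
  have hmodel : ∀ z, model f1 c x a z = (f1 z).toReal - (f1 x).toReal +
      (⟪gradient f0 x, z - x⟫_ℝ - κ * ⟪x - s, z - x⟫_ℝ) + a / 2 * ‖z - x‖ ^ 2 := by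
    intro z
    rw [model, hinner]
  set e := ‖x - s‖ ^ 2 + q + ‖y - x‖ ^ 2 with he
  have hs2 : 0 ≤ ‖x - s‖ ^ 2 := by positivity
  have hyx2 : 0 ≤ ‖y - x‖ ^ 2 := by positivity
  have hpx2 : 0 ≤ ‖p - x‖ ^ 2 := by positivity
  have he0 : 0 ≤ e := by positivity
  have hse : ‖x - s‖ ^ 2 ≤ e := by linarith
  have hye : ‖y - x‖ ^ 2 ≤ e := by linarith
  have hqe : q ≤ e := by linarith
  have hyp' : ‖y - p‖ ^ 2 ≤ Cτ / a₀ * q := by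
    rw [div_mul_eq_mul_div, le_div_iff₀ ha₀0]
    have : a₀ * ‖y - p‖ ^ 2 ≤ a * ‖y - p‖ ^ 2 := by gcongr
    linarith
  have hCa : 0 ≤ Cτ / a₀ := by positivity
  have hpx : ‖p - x‖ ^ 2 ≤ C₁ * e := by
    have h1 : ‖p - x‖ ≤ ‖y - p‖ + ‖y - x‖ := by
      rw [norm_sub_rev y p]; exact norm_sub_le_norm_sub_add_norm_sub _ _ _
    have h2 : ‖p - x‖ ^ 2 ≤ 2 * ‖y - p‖ ^ 2 + 2 * ‖y - x‖ ^ 2 := by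
      have := pow_le_pow_left₀ (norm_nonneg _) h1 2
      linarith [sq_nonneg (‖y - p‖ - ‖y - x‖), add_sq ‖y - p‖ ‖y - x‖, sub_sq ‖y - p‖ ‖y - x‖]
    have h3 : Cτ / a₀ * q ≤ Cτ / a₀ * e := by gcongr
    rw [hC₁]; linarith
  have hype : ‖y - p‖ ^ 2 ≤ C₁ * e := by
    have h3 : Cτ / a₀ * q ≤ Cτ / a₀ * e := by gcongr
    have h4 : 0 ≤ Cτ / a₀ * e := by positivity
    rw [hC₁]; linarith
  have hdescp := abs_le.mp (abs_sub_sub_inner_gradient_le hD hdiff hlip hx hp)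
  have hdescy := abs_le.mp (abs_sub_sub_inner_gradient_le hD hdiff hlip hx hy)
  have hmy := hmodel y
  have hmpz := hmodel p
  have hweak : ∀ {A : ℝ}, A ≤ C₁ + C₂ + C₃ + C₄ → A * e ≤ (C₁ + C₂ + C₃ + C₄) * e :=
    fun hA => mul_le_mul_of_nonneg_right hA he0
  have hw1 : C₁ * e ≤ (C₁ + C₂ + C₃ + C₄) * e := hweak (by linarith)
  have hw2 : C₂ * e ≤ (C₁ + C₂ + C₃ + C₄) * e := hweak (by linarith)
  have hw3 : C₃ * e ≤ (C₁ + C₂ + C₃ + C₄) * e := hweak (by linarith)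
  have hw4 : C₄ * e ≤ (C₁ + C₂ + C₃ + C₄) * e := hweak (by linarith)
  refine ⟨hy, q, p, -(c + a • (p - x)), hp, hq0, ?_, hsub, hpx.trans hw1, le_trans ?_ hw2,
    le_trans ?_ (add_le_add_right hw3 _), le_trans ?_ (add_le_add_right hw4 _)⟩
  -- The share `ω Q` of the model decrease buys `θ ω a / 2 * ‖y - x‖ ^ 2`, raising the curvature
  -- from `a` to `l + 4δ - 2γ`. After the local descent test takes `l / 2` and Young's inequality on
  -- the inertial term takes `δ - γ`, exactly `δ` is left.
  · have h1 : P.θ * P.ω * (a * ‖y - x‖ ^ 2) ≤ 2 * P.ω * Q := by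
      have := mul_le_mul_of_nonneg_left hyx (mul_nonneg P.θ_pos.le hω0)
      calc _ ≤ _ := this
        _ = (P.θ * (√(2 + P.τ) + √P.τ) ^ 2) * P.ω * Q := by ring
        _ = _ := by rw [P.θ_mul_sq]
    have h2 : a * ‖y - x‖ ^ 2 + P.θ * P.ω * (a * ‖y - x‖ ^ 2) =
        (l + 4 * P.δ - 2 * P.γ) * ‖y - x‖ ^ 2 := by rw [← haw]; ring
    have h3 := mul_le_mul_of_nonneg_left (inner_le_half_sq_add_half_sq (x - s) (y - x)) hκ0
    unfold LocalDescent at hdesc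
    unfold realObjective
    have h4 : q = Q - P.ω * Q := by rw [hq]; ring
    have h5 : κ * (‖x - s‖ ^ 2 / 2 + ‖y - x‖ ^ 2 / 2) =
        (P.δ - P.γ) * ‖x - s‖ ^ 2 + (P.δ - P.γ) * ‖y - x‖ ^ 2 := by rw [hκ]; ring
    linarith
  · have h1 : -(c + a • (p - x)) + gradient f0 p =
        (gradient f0 p - gradient f0 x) + κ • (x - s) + -(a • (p - x)) := by
      rw [hc]; abel
    have h2 : ‖-(c + a • (p - x)) + gradient f0 p‖ ≤ (L + a₁) * ‖p - x‖ + κ * ‖x - s‖ := by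
      rw [h1]
      refine (norm_add₃_le).trans ?_
      rw [norm_neg, norm_smul, norm_smul, Real.norm_of_nonneg hκ0, Real.norm_of_nonneg ha0.le]
      have h3 := hlip p hp x hx
      have h4 : a * ‖p - x‖ ≤ a₁ * ‖p - x‖ := by gcongr
      linarith
    have h3 := pow_le_pow_left₀ (norm_nonneg _) h2 2
    have h4 : ((L + a₁) * ‖p - x‖ + κ * ‖x - s‖) ^ 2 ≤
        2 * (L + a₁) ^ 2 * ‖p - x‖ ^ 2 + 2 * κ ^ 2 * ‖x - s‖ ^ 2 := by
      linarith [sq_nonneg ((L + a₁) * ‖p - x‖ - κ * ‖x - s‖),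
        add_sq ((L + a₁) * ‖p - x‖) (κ * ‖x - s‖), sub_sq ((L + a₁) * ‖p - x‖) (κ * ‖x - s‖),
        mul_pow (L + a₁) ‖p - x‖ 2, mul_pow κ ‖x - s‖ 2]
    have h5 : 2 * (L + a₁) ^ 2 * ‖p - x‖ ^ 2 ≤ 2 * (L + a₁) ^ 2 * (C₁ * e) := by gcongr
    have h6 : 2 * κ ^ 2 * ‖x - s‖ ^ 2 ≤ 2 * κ ^ 2 * e := by gcongr
    rw [hC₂]
    linarith
  -- The model is nonpositive at `p`; the descent lemma replaces the linearization of `f0` by its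
  -- value.
  · have h3 := mul_le_mul_of_nonneg_left (inner_le_half_sq_add_half_sq (x - s) (p - x)) hκ0
    have h4 : 0 ≤ a / 2 * ‖p - x‖ ^ 2 := by positivity
    have h5 : (κ / 2 + L / 2) * ‖p - x‖ ^ 2 ≤ (κ / 2 + L / 2) * (C₁ * e) := by gcongr
    have h6 : κ / 2 * ‖x - s‖ ^ 2 ≤ κ / 2 * e := by gcongr
    unfold realObjective
    rw [hC₃]
    linarith [hdescp.2]
  -- The model gap is at most `τ / 2 * Q`; the two-sided descent lemma, based at `x`, compares `f0
  -- y` with `f0 p`.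
  · have h0 : ⟪x - s, y - x⟫_ℝ - ⟪x - s, p - x⟫_ℝ = ⟪x - s, y - p⟫_ℝ := by
      rw [← inner_sub_right]; congr 1; abel
    have h3 := mul_le_mul_of_nonneg_left (inner_le_half_sq_add_half_sq (x - s) (y - p)) hκ0
    rw [← h0] at h3
    have h4 : a / 2 * ‖p - x‖ ^ 2 ≤ a₁ / 2 * (C₁ * e) := by gcongr
    have h5 : 0 ≤ a / 2 * ‖y - x‖ ^ 2 := by positivity
    have h6 : κ / 2 * ‖x - s‖ ^ 2 ≤ κ / 2 * e := by gcongr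
    have h7 : κ / 2 * ‖y - p‖ ^ 2 ≤ κ / 2 * (C₁ * e) := by gcongr
    have h8 : L / 2 * ‖y - x‖ ^ 2 ≤ L / 2 * e := by gcongr
    have h9 : L / 2 * ‖p - x‖ ^ 2 ≤ L / 2 * (C₁ * e) := by gcongr
    have h10 : Cτ * q ≤ Cτ * e := by gcongr
    unfold realObjective
    rw [hC₄]
    linarith [hdescp.1, hdescy.2]

end Iteration

/-! ### KL argument and convergence. -/

section Convergence

variable {n : ℕ} {f0 : EuclideanSpace ℝ (Fin n) → ℝ} {f1 : EuclideanSpace ℝ (Fin n) → EReal}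

/-- A global convex minorant of `f1` is added to the first-order expansion of `f0` at `p`; only the
latter contributes an error. -/
theorem eventually_le_objective (hf1 : IsProper f1) {p v : EuclideanSpace ℝ (Fin n)}
    (hdiff : DifferentiableAt ℝ f0 p)
    (hsub : ∀ z ∈ dom f1, (f1 p).toReal + ⟪v - gradient f0 p, z - p⟫_ℝ ≤ (f1 z).toReal)
    {ε : ℝ} (hε : 0 < ε) :
    ∀ᶠ u in 𝓝 p, ((realObjective f0 f1 p + ⟪u - p, v⟫_ℝ - ε * ‖u - p‖ : ℝ) : EReal) ≤
      objective f0 f1 u := by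
  have h := (hasGradientAt_iff_isLittleO.mp hdiff.hasGradientAt).def hε
  filter_upwards [h] with u hu
  by_cases hD : u ∈ dom f1
  · rw [objective_eq_coe hf1 hD, EReal.coe_le_coe_iff]
    have h1 := (abs_le.mp (Real.norm_eq_abs _ ▸ hu)).1
    have h2 := hsub u hD
    rw [inner_sub_left, real_inner_comm] at h2
    unfold realObjective
    linarith
  · rw [objective_eq_top hD]
    exact le_top

theorem mem_frechetSubdiff_objective (hf1 : IsProper f1) {p v : EuclideanSpace ℝ (Fin n)}
    (hp : p ∈ dom f1) (hdiff : DifferentiableAt ℝ f0 p)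
    (hsub : ∀ z ∈ dom f1, (f1 p).toReal + ⟪v - gradient f0 p, z - p⟫_ℝ ≤ (f1 z).toReal) :
    v ∈ frechetSubdiff (objective f0 f1) p :=
  mem_frechetSubdiff_of_eventually (objective_eq_coe hf1 hp)
    fun _ hε => eventually_le_objective hf1 hdiff hsub hε

theorem merit_eq_coe (hf1 : IsProper f1) {p : EuclideanSpace ℝ (Fin n)} (hp : p ∈ dom f1)
    (ρ : ℝ) : merit (objective f0 f1) (WithLp.toLp 2 (p, ρ)) =
      ((realObjective f0 f1 p + ρ ^ 2 / 2 : ℝ) : EReal) := by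
  rw [merit, EReal.coe_add]
  congr 1
  exact objective_eq_coe hf1 hp

theorem mem_frechetSubdiff_merit (hf1 : IsProper f1) {p v : EuclideanSpace ℝ (Fin n)}
    (hp : p ∈ dom f1) (hdiff : DifferentiableAt ℝ f0 p)
    (hsub : ∀ z ∈ dom f1, (f1 p).toReal + ⟪v - gradient f0 p, z - p⟫_ℝ ≤ (f1 z).toReal)
    (ρ : ℝ) : WithLp.toLp 2 (v, ρ) ∈
      frechetSubdiff (merit (objective f0 f1)) (WithLp.toLp 2 (p, ρ)) := by
  refine mem_frechetSubdiff_of_eventually (merit_eq_coe hf1 hp ρ) fun ε hε => ?_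
  have hcont : Tendsto (fun z : WithLp 2 (EuclideanSpace ℝ (Fin n) × ℝ) => z.fst)
      (𝓝 (WithLp.toLp 2 (p, ρ))) (𝓝 p) :=
    (WithLp.prod_continuous_ofLp 2 _ _).fst.tendsto (WithLp.toLp 2 (p, ρ))
  filter_upwards [hcont.eventually (eventually_le_objective hf1 hdiff hsub hε)] with z hz
  rw [merit]
  refine le_trans ?_ (add_le_add_left hz _)
  rw [← EReal.coe_add, EReal.coe_le_coe_iff, WithLp.prod_inner_apply]
  have h1 : ‖z.fst - p‖ ≤ ‖z - WithLp.toLp 2 (p, ρ)‖ := by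
    refine le_of_sq_le_sq ?_ (norm_nonneg _)
    rw [WithLp.prod_norm_sq_eq_of_L2]
    exact le_add_of_nonneg_right (by positivity)
  have h2 := mul_le_mul_of_nonneg_left h1 hε.le
  -- The term `ρ ^ 2 / 2` lies above its tangent, so the second variable adds no error.
  have h3 : ⟪(z - WithLp.toLp 2 (p, ρ)).snd, ρ⟫_ℝ = ρ * (z.snd - ρ) := rfl
  change _ + (⟪z.fst - p, v⟫_ℝ + ⟪(z - WithLp.toLp 2 (p, ρ)).snd, ρ⟫_ℝ) - _ ≤ _
  rw [h3]
  linarith [sq_nonneg (z.snd - ρ), sub_sq z.snd ρ]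

theorem norm_toLp_prod_le {E F : Type*} [SeminormedAddCommGroup E] [SeminormedAddCommGroup F]
    (u : E) (v : F) : ‖WithLp.toLp 2 (u, v)‖ ≤ ‖u‖ + ‖v‖ := by
  refine le_of_sq_le_sq ?_ (by positivity)
  rw [WithLp.prod_norm_sq_eq_of_L2]
  change ‖u‖ ^ 2 + ‖v‖ ^ 2 ≤ _
  nlinarith [mul_nonneg (norm_nonneg u) (norm_nonneg v)]

/-- Along a convergent sequence of points with convergent subgradients, the objective values
converge to the value at the limit point. -/
theorem realObjective_eq_of_tendsto (hf1 : IsProper f1) (hlsc : LowerSemicontinuous f1)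
    (hcont : ∀ z ∈ closure (dom f1), ContinuousAt f0 z) {L : ℝ}
    (hlip : ∀ x ∈ dom f1, ∀ y ∈ dom f1, ‖gradient f0 x - gradient f0 y‖ ≤ L * ‖x - y‖)
    {p v : ℕ → EuclideanSpace ℝ (Fin n)} {ps vs : EuclideanSpace ℝ (Fin n)} {Fs : ℝ}
    (hpD : ∀ k, p k ∈ dom f1) (hp : Tendsto p atTop (𝓝 ps)) (hv : Tendsto v atTop (𝓝 vs))
    (hval : Tendsto (fun k => realObjective f0 f1 (p k)) atTop (𝓝 Fs))
    (hsub : ∀ k, ∀ z ∈ dom f1,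
      (f1 (p k)).toReal + ⟪v k - gradient f0 (p k), z - p k⟫_ℝ ≤ (f1 z).toReal) :
    ps ∈ dom f1 ∧ realObjective f0 f1 ps = Fs := by
  have hf0 : Tendsto (fun k => f0 (p k)) atTop (𝓝 (f0 ps)) :=
    (hcont ps (mem_closure_of_tendsto hp (Eventually.of_forall hpD))).tendsto.comp hp
  have hg : Tendsto (fun k => (f1 (p k)).toReal) atTop (𝓝 (Fs - f0 ps)) := by
    simpa [realObjective] using hval.sub hf0
  have hle : f1 ps ≤ ((Fs - f0 ps : ℝ) : EReal) := by
    by_contra! hlt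
    obtain ⟨r, hr1, hr2⟩ := EReal.lt_iff_exists_real_btwn.mp hlt
    have hr1' : Fs - f0 ps < r := by exact_mod_cast hr1
    obtain ⟨k, hk1, hk2⟩ := ((hp.eventually (hlsc ps r hr2)).and
      (hg.eventually_lt_const hr1')).exists
    rw [← hf1.coe_toReal (hpD k)] at hk1
    have hk1' : r < (f1 (p k)).toReal := by exact_mod_cast hk1
    exact lt_asymm hk1' hk2
  have hps : ps ∈ dom f1 := hle.trans_lt (EReal.coe_lt_top _)
  refine ⟨hps, ?_⟩
  rw [← hf1.coe_toReal hps, EReal.coe_le_coe_iff] at hle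
  -- Lower semicontinuity gave one inequality; the subgradient inequalities tested at the limit
  -- point `ps` give the other.
  have hsubs : Tendsto (fun k => ps - p k) atTop (𝓝 0) := by
    simpa using hp.const_sub ps
  have hgrad : Tendsto (fun k => gradient f0 (p k)) atTop (𝓝 (gradient f0 ps)) := by
    rw [tendsto_iff_norm_sub_tendsto_zero]
    refine squeeze_zero (fun _ => norm_nonneg _) (fun k => hlip _ (hpD k) _ hps) ?_
    simpa using (tendsto_iff_norm_sub_tendsto_zero.mp hp).const_mul L
  have hlim := hg.add ((hv.sub hgrad).inner hsubs (𝕜 := ℝ))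
  have hge := le_of_tendsto' hlim fun k => hsub k ps hps
  rw [inner_zero_right, add_zero] at hge
  unfold realObjective
  linarith

/-- Convergence of an abstract descent method under the KL property of the merit function. The
subgradient `v k` is taken at a point `p k` close to the iterate `x k`. -/
theorem exists_tendsto_isStationary (hf1 : IsProper f1) (hlsc : LowerSemicontinuous f1)
    (hcont : ∀ z ∈ closure (dom f1), ContinuousAt f0 z)
    (hdiff : ∀ z ∈ dom f1, DifferentiableAt ℝ f0 z) {L : ℝ}
    (hlip : ∀ x ∈ dom f1, ∀ y ∈ dom f1, ‖gradient f0 x - gradient f0 y‖ ≤ L * ‖x - y‖)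
    (hKL : IsKL (merit (objective f0 f1)))
    {x p v : ℕ → EuclideanSpace ℝ (Fin n)} {d Φ : ℕ → ℝ} {A B c : ℝ} (hA : 0 ≤ A) (hB : 0 ≤ B)
    (hx : Bornology.IsBounded (Set.range x)) (hd : ∀ k, 0 ≤ d k) (hc : ∀ k, c ≤ Φ k)
    (hΦ : ∀ k, Φ (k + 1) + d k ^ 2 ≤ Φ k) (hstep : ∀ k, ‖x (k + 1) - x k‖ ≤ A * d (k + 1))
    (hpD : ∀ k, p k ∈ dom f1) (hpx : ∀ k, ‖p k - x k‖ ≤ B * (d k + d (k + 1)))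
    (hv : ∀ k, ‖v k‖ ≤ B * (d k + d (k + 1)))
    (hsub : ∀ k, ∀ z ∈ dom f1,
      (f1 (p k)).toReal + ⟪v k - gradient f0 (p k), z - p k⟫_ℝ ≤ (f1 z).toReal)
    (hup : ∀ k, realObjective f0 f1 (p k) ≤ Φ k + (B * (d k + d (k + 1))) ^ 2)
    (hlow : ∀ k, Φ (k + 1) ≤ realObjective f0 f1 (p k) + (B * (d k + d (k + 1))) ^ 2) :
    ∃ xs, Tendsto x atTop (𝓝 xs) ∧ IsStationary (objective f0 f1) xs := by
  have hanti : Antitone Φ := antitone_nat_of_succ_le fun k => by linarith [hΦ k, sq_nonneg (d k)]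
  obtain ⟨Fs, hFs⟩ : ∃ Fs, Tendsto Φ atTop (𝓝 Fs) :=
    ⟨_, tendsto_atTop_ciInf hanti ⟨c, by rintro _ ⟨k, rfl⟩; exact hc k⟩⟩
  have hFsle : ∀ k, Fs ≤ Φ k := fun k => hanti.le_of_tendsto hFs k
  have hFs1 : Tendsto (fun k => Φ (k + 1)) atTop (𝓝 Fs) := (tendsto_add_atTop_iff_nat 1).mpr hFs
  have hd0 : Tendsto d atTop (𝓝 0) := by
    have h1 : Tendsto (fun k => d k ^ 2) atTop (𝓝 0) :=
      squeeze_zero (g := fun k => Φ k - Φ (k + 1)) (fun k => sq_nonneg _)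
        (fun k => by linarith [hΦ k])
        (by simpa using hFs.sub hFs1)
    have h2 := h1.sqrt
    simpa [Real.sqrt_sq (hd _)] using h2
  have hS0 : Tendsto (fun k => B * (d k + d (k + 1))) atTop (𝓝 0) := by
    simpa using (hd0.add ((tendsto_add_atTop_iff_nat 1).mpr hd0)).const_mul B
  have hS2 : Tendsto (fun k => (B * (d k + d (k + 1))) ^ 2) atTop (𝓝 0) := by
    simpa using hS0.pow 2
  have hval : Tendsto (fun k => realObjective f0 f1 (p k)) atTop (𝓝 Fs) := by
    refine tendsto_of_tendsto_of_tendsto_of_le_of_le (by simpa using hFs1.sub hS2)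
      (by simpa using hFs.add hS2) (fun k => ?_) hup
    simpa using hlow k
  have hv0 : Tendsto v atTop (𝓝 0) := squeeze_zero_norm hv hS0
  obtain ⟨xs, -, σ, hσ, hclus⟩ := tendsto_subseq_of_bounded hx fun k => Set.mem_range_self k
  have hpσ : Tendsto (p ∘ σ) atTop (𝓝 xs) := by
    have h1 : Tendsto (fun k => p k - x k) atTop (𝓝 0) := squeeze_zero_norm hpx hS0
    simpa [Function.comp_def] using (h1.comp hσ.tendsto_atTop).add hclus
  obtain ⟨hxs, hfxs⟩ := realObjective_eq_of_tendsto hf1 hlsc hcont hlip (fun k => hpD (σ k)) hpσ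
    (hv0.comp hσ.tendsto_atTop) (hval.comp hσ.tendsto_atTop) fun k => hsub (σ k)
  have hstat : IsStationary (objective f0 f1) xs := by
    refine ⟨by rw [dom, Set.mem_ofPred_eq, objective_eq_coe hf1 hxs]; exact EReal.coe_lt_top _,
      p ∘ σ, v ∘ σ, hpσ, ?_, fun k => ?_, hv0.comp hσ.tendsto_atTop⟩
    · simp only [Function.comp_apply, objective_eq_coe hf1 (hpD _), objective_eq_coe hf1 hxs, hfxs]
      exact (continuous_coe_real_ereal.tendsto _).comp (hval.comp hσ.tendsto_atTop)
    · exact mem_frechetSubdiff_objective hf1 (hpD _) (hdiff _ (hpD _)) (hsub _)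
  refine ⟨xs, ?_, hstat⟩
  -- The factor `√2` makes `ρ k ^ 2 / 2` equal to the error in `hlow`, which lifts the merit value
  -- to at least `Φ (k + 1)`.
  set ρ : ℕ → ℝ := fun k => √2 * (B * (d k + d (k + 1))) with hρ
  have hρ0 : Tendsto ρ atTop (𝓝 0) := by simpa using hS0.const_mul √2
  have hρ2 : ∀ k, ρ k ^ 2 / 2 = (B * (d k + d (k + 1))) ^ 2 := by
    intro k
    simp only [hρ]
    rw [mul_pow, Real.sq_sqrt zero_le_two]
    ring
  set F := merit (objective f0 f1)
  have hFxs : F (WithLp.toLp 2 (xs, 0)) = (Fs : EReal) := by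
    rw [← hfxs]
    simpa using merit_eq_coe (f0 := f0) hf1 hxs 0
  have hmerit : ∀ k, F (WithLp.toLp 2 (p k, ρ k)) =
      ((realObjective f0 f1 (p k) + (B * (d k + d (k + 1))) ^ 2 : ℝ) : EReal) := by
    intro k
    rw [← hρ2]
    exact merit_eq_coe hf1 (hpD k) _
  have hfre : ∀ k, WithLp.toLp 2 (v k, ρ k) ∈ frechetSubdiff F (WithLp.toLp 2 (p k, ρ k)) :=
    fun k => mem_frechetSubdiff_merit hf1 (hpD k) (hdiff _ (hpD k)) (hsub k) (ρ k)
  have hmval : Tendsto (fun k => realObjective f0 f1 (p k) + (B * (d k + d (k + 1))) ^ 2) atTop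
      (𝓝 Fs) := by simpa using hval.add hS2
  have htoLp : Continuous fun q : EuclideanSpace ℝ (Fin n) × ℝ => WithLp.toLp 2 q :=
    WithLp.prod_continuous_toLp 2 _ _
  have hne : (limitingSubdiff F (WithLp.toLp 2 (xs, 0))).Nonempty := by
    refine ⟨WithLp.toLp 2 (0, 0), ?_, fun k => WithLp.toLp 2 (p (σ k), ρ (σ k)),
      fun k => WithLp.toLp 2 (v (σ k), ρ (σ k)), ?_, ?_, fun k => hfre (σ k), ?_⟩
    · rw [dom, Set.mem_ofPred_eq, hFxs]; exact EReal.coe_lt_top _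
    · exact (htoLp.tendsto _).comp (hpσ.prodMk_nhds (hρ0.comp hσ.tendsto_atTop))
    · simp only [hmerit, hFxs]
      exact (continuous_coe_real_ereal.tendsto _).comp (hmval.comp hσ.tendsto_atTop)
    · exact (htoLp.tendsto _).comp
        ((hv0.comp hσ.tendsto_atTop).prodMk_nhds (hρ0.comp hσ.tendsto_atTop))
  obtain ⟨υ, hυ, U, hU, φ, hφ0, hφnn, hφ⟩ := (hKL _ hne).exists_sub_le_mul_norm hFxs
  obtain ⟨r, hr, hball⟩ := Metric.mem_nhds_iff.mp hU
  have hΦ0 : Tendsto (fun k => Φ k - Fs) atTop (𝓝[≥] 0) :=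
    tendsto_nhdsWithin_iff.mpr ⟨by simpa using hFs.sub_const Fs,
      Eventually.of_forall fun k => by simpa using hFsle k⟩
  have hev : ∀ᶠ k in atTop, B * (d k + d (k + 1)) < r / 3 ∧ ρ k < r / 3 ∧
      realObjective f0 f1 (p k) + (B * (d k + d (k + 1))) ^ 2 < Fs + υ :=
    (hS0.eventually_lt_const (by positivity)).and ((hρ0.eventually_lt_const (by positivity)).and
      (hmval.eventually_lt_const (by linarith)))
  obtain ⟨K₀, hK₀⟩ := eventually_atTop.mp hev
  -- The radius is `r / 3` because `p k - x k`, `x k - xs` and `ρ k` each use a third of the KL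
  -- ball. The factor `12 * B` is fixed by the AM-GM step at the end.
  refine tendsto_of_telescoping_near_cluster (d := d) (ψ := fun k => 12 * B * φ (Φ k - Fs))
    (A := A) (r := r / 3) (K₀ := K₀) hA (by positivity) hd ?_ hd0
    (by simpa using (hφ0.comp hΦ0).const_mul (12 * B)) hstep (fun k hk hkr => ?_) hσ hclus
  · filter_upwards [hFs.eventually_lt_const (show Fs < Fs + υ by linarith)] with k hk
    exact mul_nonneg (by positivity) (hφnn _ (by linarith [hFsle k]) (by linarith))
  · obtain ⟨h1, h2, h3⟩ := hK₀ k hk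
    have hdk := hΦ (k + 1)
    -- Without strict decrease the KL estimate is unavailable, but then `d (k + 1) = 0` and the
    -- recursion is trivial.
    rcases (hanti (Nat.le_succ (k + 1))).eq_or_lt with heq | hlt
    · have h4 : d (k + 1) = 0 := by
        have heq' : Φ (k + 1 + 1) = Φ (k + 1) := heq
        have : d (k + 1) ^ 2 ≤ 0 := by linarith
        exact pow_eq_zero_iff two_ne_zero |>.mp (le_antisymm this (sq_nonneg _))
      have heq' : Φ (k + 2) = Φ (k + 1) := heq
      simp only [h4, heq', sub_self, add_zero, mul_zero]
      exact hd k
    · have hlt' : Φ (k + 2) < Φ (k + 1) := hlt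
      have hρk : 0 ≤ ρ k :=
        mul_nonneg (Real.sqrt_nonneg _) (mul_nonneg hB (add_nonneg (hd _) (hd _)))
      have hmem : WithLp.toLp 2 (p k, ρ k) ∈ U := by
        refine hball ?_
        rw [Metric.mem_ball, dist_eq_norm, ← WithLp.toLp_sub, Prod.mk_sub_mk, sub_zero]
        refine (norm_toLp_prod_le _ _).trans_lt ?_
        rw [Real.norm_of_nonneg hρk]
        have := norm_sub_le_norm_sub_add_norm_sub (p k) (x k) xs
        linarith [hpx k]
      obtain ⟨hΔ, hle⟩ := hφ _ hmem _ (frechetSubdiff_subset_limitingSubdiff _ _ (hfre k))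
        (realObjective f0 f1 (p k) + (B * (d k + d (k + 1))) ^ 2 - Fs) (Φ (k + 1) - Fs)
        (Φ (k + 2) - Fs) (by rw [hmerit]; congr 1; ring) (by linarith [hFsle (k + 2)])
        (by linarith) (by linarith [hlow k]) (by linarith)
      set Δ := φ (Φ (k + 1) - Fs) - φ (Φ (k + 2) - Fs)
      set S := d k + d (k + 1)
      have hS : 0 ≤ S := add_nonneg (hd _) (hd _)
      have hw : ‖WithLp.toLp 2 (v k, ρ k)‖ ≤ 3 * (B * S) := by
        refine (norm_toLp_prod_le _ _).trans ?_
        rw [Real.norm_of_nonneg hρk]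
        have h4 : √2 ≤ 2 := Real.sqrt_le_iff.mpr (by norm_num)
        have h5 : ρ k ≤ 2 * (B * S) := mul_le_mul_of_nonneg_right h4 (mul_nonneg hB hS)
        linarith [hv k]
      have h6 : d (k + 1) ^ 2 ≤ Δ * (3 * (B * S)) := by
        have h7 := mul_le_mul_of_nonneg_left hw hΔ
        change Φ (k + 2) + d (k + 1) ^ 2 ≤ Φ (k + 1) at hdk
        linarith
      -- AM-GM: `16 * d (k + 1) ^ 2 ≤ 4 * S * (12 * B * Δ) ≤ (S + 12 * B * Δ) ^ 2`.
      have h8 : 4 * d (k + 1) ≤ S + 12 * B * Δ := by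
        refine le_of_sq_le_sq ?_ (by positivity)
        linarith [sq_nonneg (S - 12 * B * Δ), add_sq S (12 * B * Δ), sub_sq S (12 * B * Δ),
          mul_pow 4 (d (k + 1)) 2]
      have h9 : 12 * B * φ (Φ (k + 1) - Fs) - 12 * B * φ (Φ (k + 2) - Fs) = 12 * B * Δ := by
        rw [← mul_sub]
      rw [h9]
      linarith

end Convergence

end I2Piano

/-! ### Application to the i²Piano iterates. -/

open I2Piano in
theorem theorem4p1 {n : ℕ}
    (f0 : EuclideanSpace ℝ (Fin n) → ℝ) (f1 : EuclideanSpace ℝ (Fin n) → EReal)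
    (hf1_proper : I2Piano.IsProper f1) (hf1_lsc : LowerSemicontinuous f1)
    (hf1_convex : I2Piano.IsConvex f1)
    (Ω₀ : Set (EuclideanSpace ℝ (Fin n))) (hΩ₀ : IsOpen Ω₀)
    (hdom : closure (I2Piano.dom f1) ⊆ Ω₀) (hf0 : ContDiffOn ℝ 1 f0 Ω₀)
    (L : ℝ) (hL : 0 < L)
    (hf0_lip : ∀ x ∈ I2Piano.dom f1, ∀ y ∈ I2Piano.dom f1,
      ‖gradient f0 x - gradient f0 y‖ ≤ L * ‖x - y‖)
    (hf_bdd : ∃ c : ℝ, ∀ x, (c : EReal) ≤ I2Piano.objective f0 f1 x)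
    (hKL : I2Piano.IsKL (I2Piano.merit (I2Piano.objective f0 f1)))
    (P : I2Piano.Params)
    (xm1 : EuclideanSpace ℝ (Fin n)) (x : ℕ → EuclideanSpace ℝ (Fin n))
    (hx : I2Piano.IsGenerated P f0 f1 xm1 x)
    (hx_bdd : Bornology.IsBounded (Set.range x)) :
    ∃ xstar : EuclideanSpace ℝ (Fin n),
      Filter.Tendsto x Filter.atTop (nhds xstar) ∧
      I2Piano.IsStationary (I2Piano.objective f0 f1) xstar := by
  have hdiffΩ : ∀ z ∈ closure (dom f1), DifferentiableAt ℝ f0 z := fun z hz =>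
    (hf0.differentiableOn one_ne_zero).differentiableAt (hΩ₀.mem_nhds (hdom hz))
  have hdiff : ∀ z ∈ dom f1, DifferentiableAt ℝ f0 z := fun z hz => hdiffΩ z (subset_closure hz)
  obtain ⟨C, hC, hiter⟩ := exists_iterationEstimate P hf1_proper hf1_lsc hf1_convex hdiff hL
    hf0_lip
  obtain ⟨-, hx0, hgen⟩ := hx
  have hxD : ∀ k, x k ∈ dom f1 := by
    intro k
    induction k with
    | zero => exact hx0
    | succ k ih => exact (hiter _ _ _ ih (hgen k)).1
  choose q p ξ hest using fun k => (hiter _ _ _ (hxD k) (hgen k)).2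
  obtain ⟨c, hc⟩ := hf_bdd
  have hγ := P.γ_pos
  have hδ : 0 < P.δ := hγ.trans_le P.γ_le_δ
  set w : ℕ → ℝ := fun k => ‖x k - prev xm1 x k‖ with hw
  have hw1 : ∀ k, w (k + 1) = ‖x (k + 1) - x k‖ := fun k => rfl
  set d : ℕ → ℝ := fun k => √(P.γ * w k ^ 2 + q k) with hd_def
  have hd : ∀ k, 0 ≤ d k := fun k => Real.sqrt_nonneg _
  have hd2 : ∀ k, d k ^ 2 = P.γ * w k ^ 2 + q k := fun k =>
    Real.sq_sqrt (add_nonneg (by positivity) (hest k).nonneg)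
  have hwd : ∀ k, w k ^ 2 ≤ 1 / P.γ * d k ^ 2 := by
    intro k
    rw [hd2, mul_add, ← mul_assoc, one_div_mul_cancel hγ.ne', one_mul]
    exact le_add_of_nonneg_right (mul_nonneg (by positivity) (hest k).nonneg)
  have hqd : ∀ k, q k ≤ d k ^ 2 := by
    intro k
    rw [hd2]
    exact le_add_of_nonneg_left (by positivity)
  -- The summand `P.δ / P.γ` pays for `δ‖x (k + 1) - x k‖ ^ 2`, by which `Φ (k + 1)` exceeds the
  -- objective.
  set B := √(C * (1 / P.γ + 1) + P.δ / P.γ) with hB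
  have hdd : ∀ k, d k ^ 2 + d (k + 1) ^ 2 ≤ (d k + d (k + 1)) ^ 2 := by
    intro k
    have := mul_nonneg (hd k) (hd (k + 1))
    linarith [add_sq (d k) (d (k + 1))]
  have herr : ∀ k, C * (‖x k - prev xm1 x k‖ ^ 2 + q k + ‖x (k + 1) - x k‖ ^ 2) +
      P.δ * ‖x (k + 1) - x k‖ ^ 2 ≤ (B * (d k + d (k + 1))) ^ 2 := by
    intro k
    rw [mul_pow, hB, Real.sq_sqrt (by positivity), add_mul]
    refine add_le_add ?_ ?_
    · rw [mul_assoc]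
      refine mul_le_mul_of_nonneg_left ?_ hC
      refine le_trans ?_ (mul_le_mul_of_nonneg_left (hdd k) (by positivity))
      have h1 := hwd k
      have h2 := hwd (k + 1)
      rw [hw1] at h2
      linarith [hqd k, sq_nonneg (d (k + 1))]
    · have h2 := hwd (k + 1)
      rw [hw1] at h2
      have h3 : d (k + 1) ^ 2 ≤ (d k + d (k + 1)) ^ 2 :=
        le_trans (le_add_of_nonneg_left (sq_nonneg _)) (hdd k)
      calc P.δ * ‖x (k + 1) - x k‖ ^ 2 ≤ P.δ * (1 / P.γ * d (k + 1) ^ 2) := by gcongr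
        _ = P.δ / P.γ * d (k + 1) ^ 2 := by ring
        _ ≤ _ := by gcongr
  have herr' : ∀ k, C * (‖x k - prev xm1 x k‖ ^ 2 + q k + ‖x (k + 1) - x k‖ ^ 2) ≤
      (B * (d k + d (k + 1))) ^ 2 := fun k =>
    le_trans (le_add_of_nonneg_right (by positivity)) (herr k)
  have hBS : ∀ k, 0 ≤ B * (d k + d (k + 1)) := fun k =>
    mul_nonneg (Real.sqrt_nonneg _) (add_nonneg (hd _) (hd _))
  refine exists_tendsto_isStationary (p := p) (v := fun k => ξ k + gradient f0 (p k)) (d := d)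
    (Φ := fun k => realObjective f0 f1 (x k) + P.δ * w k ^ 2) (A := √(1 / P.γ)) (B := B) (c := c)
    hf1_proper hf1_lsc (fun z hz => (hdiffΩ z hz).continuousAt) hdiff hf0_lip hKL
    (Real.sqrt_nonneg _) (Real.sqrt_nonneg _) hx_bdd hd (fun k => ?_) (fun k => ?_) (fun k => ?_)
    (fun k => (hest k).mem_dom) (fun k => ?_) (fun k => ?_) (fun k => ?_) (fun k => ?_)
    (fun k => ?_)
  · have h1 := hc (x k)
    rw [objective_eq_coe hf1_proper (hxD k), EReal.coe_le_coe_iff] at h1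
    exact h1.trans (le_add_of_nonneg_right (by positivity))
  · simp only [hd2, hw1]
    exact (hest k).decrease
  · refine le_of_sq_le_sq ?_ (mul_nonneg (Real.sqrt_nonneg _) (hd _))
    rw [mul_pow, Real.sq_sqrt (by positivity)]
    exact hwd (k + 1)
  · exact le_of_sq_le_sq ((hest k).norm_sub_sq_le.trans (herr' k)) (hBS k)
  · exact le_of_sq_le_sq ((hest k).norm_subgradient_sq_le.trans (herr' k)) (hBS k)
  · simpa using (hest k).subgradient
  · refine (hest k).exact_le.trans ?_
    have : 0 ≤ P.δ * w k ^ 2 := by positivity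
    linarith [herr' k]
  · have h1 := (hest k).le_exact
    simp only [hw1]
    linarith [herr k]
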